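/- Let $S^2=\mathbb{C}\cup\{\infty\}$ be the Riemann sphere and let $L_1,L_2$ be holomorphic line bundles over $S^2$. The degree $\deg(L)$ of a holomorphic line bundle $L$ is the degree of the divisor of any meromorphic section of $L$ that is not identically zero. Let $[\eta]\in\mathcal{H}^{0,1}(\mathrm{Hom}(L_2,L_1))=\Omega^{0,1}(\mathrm{Hom}(L_2,L_1))/D''\,\Omega^{0}(\mathrm{Hom}(L_2,L_1))$ be a Dolbeault cohomology class, i.e. an extension class of $L_2$ by $L_1$. The associated extension $0\to L_1\to E\to L_2\to 0$ is the smooth bundle $E=L_1\oplus L_2$ with the holomorphic structure $D''_E(s_1,s_2)=(D''s_1+\eta\, s_2,\ D''s_2)$, which up to isomorphism of extensions does not depend on the representative $\eta$. Put $$\mathrm{div}[\eta]=\sup\{\deg(J)\mid J\subset E\ \text{a holomorphic line subbundle}\}.$$ Then $$\mathrm{div}[\eta]\le\max\{\deg(L_1),\deg(L_2)\}.$$ Moreover, if $\deg(L_2)>\deg(L_1)$, then $\mathrm{div}[\eta]=\max\{\deg(L_1),\deg(L_2)\}$ if and only if $[\eta]=0$. -/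

import Mathlib

open scoped Manifold Topology ContDiff Bundle

set_option linter.unusedSectionVars false

noncomputable section

/-! ### The Riemann sphere -/

namespace RiemannSphere

/-- The coordinate `z` on the complement of the point `∞`. -/
def zChart : OpenPartialHomeomorph (OnePoint ℂ) ℂ :=
  (OnePoint.isOpenEmbedding_coe.toOpenPartialHomeomorph ((↑) : ℂ → OnePoint ℂ)).symm

/-- The involution `z ↦ 1 / z` of the sphere. -/
def inv : OnePoint ℂ → OnePoint ℂ
  | OnePoint.infty => ((0 : ℂ) : OnePoint ℂ)
  | OnePoint.some z => if z = 0 then OnePoint.infty else ((z⁻¹ : ℂ) : OnePoint ℂ)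

@[simp] lemma inv_infty : inv OnePoint.infty = ((0 : ℂ) : OnePoint ℂ) := rfl

@[simp] lemma inv_zero : inv ((0 : ℂ) : OnePoint ℂ) = OnePoint.infty := if_pos rfl

lemma inv_coe {z : ℂ} (hz : z ≠ 0) : inv (z : OnePoint ℂ) = ((z⁻¹ : ℂ) : OnePoint ℂ) := if_neg hz

lemma inv_inv (x : OnePoint ℂ) : inv (inv x) = x := by
  induction x using OnePoint.rec with
  | infty => simp
  | coe z =>
    by_cases hz : z = 0
    · subst hz; simp
    · rw [inv_coe hz, inv_coe (inv_ne_zero hz), _root_.inv_inv]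

lemma continuous_inv : Continuous inv := by
  rw [continuous_iff_continuousAt]
  intro x
  induction x using OnePoint.rec with
  | infty =>
    rw [OnePoint.continuousAt_infty', inv_infty, Filter.coclosedCompact_eq_cocompact,
      ← Metric.cobounded_eq_cocompact]
    have h : Filter.Tendsto (fun z : ℂ => ((z⁻¹ : ℂ) : OnePoint ℂ)) (Bornology.cobounded ℂ)
        (𝓝 ((0 : ℂ) : OnePoint ℂ)) :=
      (OnePoint.continuous_coe.tendsto 0).comp Filter.tendsto_inv₀_cobounded
    refine h.congr' ?_
    filter_upwards [Bornology.isBounded_def.1 (Bornology.isBounded_singleton (x := (0 : ℂ)))]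
      with z hz
    exact (inv_coe hz).symm
  | coe z =>
    rw [OnePoint.continuousAt_coe]
    by_cases hz : z = 0
    · subst hz
      rw [continuousAt_iff_punctured_nhds]
      have h : Filter.Tendsto (fun z : ℂ => ((z⁻¹ : ℂ) : OnePoint ℂ)) (𝓝[≠] 0)
          (𝓝 OnePoint.infty) := by
        have h2 := (OnePoint.tendsto_coe_infty (X := ℂ))
        rw [Filter.coclosedCompact_eq_cocompact, ← Metric.cobounded_eq_cocompact] at h2
        exact h2.comp Filter.tendsto_inv₀_nhdsNE_zero
      simp only [Function.comp_def, inv_zero]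
      refine h.congr' ?_
      filter_upwards [self_mem_nhdsWithin] with z hz
      rw [inv_coe hz]
    · have h : ContinuousAt (fun z : ℂ => ((z⁻¹ : ℂ) : OnePoint ℂ)) z :=
        OnePoint.continuous_coe.continuousAt.comp (continuousAt_inv₀ hz)
      refine h.congr ?_
      filter_upwards [isOpen_ne.mem_nhds hz] with z hz
      rw [Function.comp_apply, inv_coe hz]

/-- `z ↦ 1 / z` as a homeomorphism of the sphere. -/
def invHomeomorph : OnePoint ℂ ≃ₜ OnePoint ℂ where
  toFun := inv
  invFun := inv
  left_inv := inv_inv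
  right_inv := inv_inv
  continuous_toFun := continuous_inv
  continuous_invFun := continuous_inv

/-- The coordinate `w = 1 / z` on the complement of the point `0`, with `w(∞) = 0`. -/
def wChart : OpenPartialHomeomorph (OnePoint ℂ) ℂ :=
  invHomeomorph.toOpenPartialHomeomorph.trans zChart

/-- The atlas `{z, 1 / z}` of the Riemann sphere `S² = ℂ ∪ {∞}`. -/
instance : ChartedSpace ℂ (OnePoint ℂ) where
  atlas := {zChart, wChart}
  chartAt x := x.elim wChart (fun _ => zChart)
  mem_chart_source x := by
    induction x using OnePoint.rec with
    | infty => simp [wChart, zChart, invHomeomorph]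
    | coe z => simp [zChart]
  chart_mem_atlas x := by
    induction x using OnePoint.rec with
    | infty => simp
    | coe z => simp

lemma zChart_symm_apply (z : ℂ) : zChart.symm z = (z : OnePoint ℂ) := rfl

lemma zChart_coe (z : ℂ) : zChart (z : OnePoint ℂ) = z :=
  zChart.right_inv (x := z) (by simp [zChart])

lemma wChart_symm_apply (w : ℂ) : wChart.symm w = inv (w : OnePoint ℂ) := rfl

lemma wChart_apply (x : OnePoint ℂ) : wChart x = zChart (inv x) := rfl

lemma contDiffOn_transition : ContDiffOn ℂ ω (fun z : ℂ => z⁻¹) {0}ᶜ :=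
  contDiffOn_inv ℂ

instance : IsManifold 𝓘(ℂ, ℂ) ω (OnePoint ℂ) := by
  apply isManifold_of_contDiffOn
  have key1 : ContDiffOn ℂ ω (zChart.symm.trans wChart) (zChart.symm.trans wChart).source := by
    refine (contDiffOn_transition.mono ?_).congr ?_
    · intro z hz
      rintro rfl
      simp [zChart, wChart, invHomeomorph] at hz
    · intro z hz
      have hz0 : z ≠ 0 := by
        rintro rfl
        simp [zChart, wChart, invHomeomorph] at hz
      change zChart (inv (z : OnePoint ℂ)) = z⁻¹
      rw [inv_coe hz0, zChart_coe]
  have key2 : ContDiffOn ℂ ω (wChart.symm.trans zChart) (wChart.symm.trans zChart).source := by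
    refine (contDiffOn_transition.mono ?_).congr ?_
    · intro z hz
      rintro rfl
      simp [zChart, wChart, invHomeomorph] at hz
    · intro z hz
      have hz0 : z ≠ 0 := by
        rintro rfl
        simp [zChart, wChart, invHomeomorph] at hz
      change zChart (inv (z : OnePoint ℂ)) = z⁻¹
      rw [inv_coe hz0, zChart_coe]
  have key3 (e : OpenPartialHomeomorph (OnePoint ℂ) ℂ) :
      ContDiffOn ℂ ω (e.symm.trans e) (e.symm.trans e).source := by
    refine contDiffOn_id.congr ?_
    intro z hz
    exact e.right_inv (by simpa using hz.1)
  rintro e e' (rfl | rfl) (rfl | rfl)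
  · simpa using key3 zChart
  · simpa using key1
  · simpa using key2
  · simpa using key3 wChart

end RiemannSphere

section Bundles

open Bundle

variable {M : Type*} [TopologicalSpace M] [ChartedSpace ℂ M]
variable {F : Type*} [NormedAddCommGroup F] [NormedSpace ℂ F]
variable {V : M → Type*} [∀ x, AddCommGroup (V x)] [∀ x, Module ℂ (V x)]
  [∀ x, TopologicalSpace (V x)]
  [TopologicalSpace (TotalSpace F V)] [FiberBundle F V]

variable (F) in
/-- `s` is a section of `V`, smooth (in the real sense) at the point `x`. -/
def SmoothSectionAt (s : ∀ x, V x) (x : M) : Prop :=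
  ContMDiffAt 𝓘(ℝ, ℂ) (𝓘(ℝ, ℂ).prod 𝓘(ℝ, F)) ∞ (fun y => TotalSpace.mk' F y (s y)) x

variable (F) in
/-- The section `s`, read in the chart of `M` and the trivialization of `V` chosen at `x`. -/
def localRep (s : ∀ x, V x) (x : M) (z : ℂ) : F :=
  (trivializationAt F V x ⟨(chartAt ℂ x).symm z, s ((chartAt ℂ x).symm z)⟩).2

lemma smoothSectionAt_iff {s : ∀ x, V x} {x : M} :
    SmoothSectionAt F s x ↔ ContMDiffAt 𝓘(ℝ, ℂ) 𝓘(ℝ, F) ∞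
      (fun y => (trivializationAt F V x ⟨y, s y⟩).2) x :=
  contMDiffAt_section x

lemma SmoothSectionAt.differentiableAt_localRep {s : ∀ x, V x} {x : M}
    (h : SmoothSectionAt F s x) :
    DifferentiableAt ℝ (localRep F s x) (chartAt ℂ x x) := by
  rw [smoothSectionAt_iff] at h
  have h2 := (contMDiffAt_iff.1 h).2
  have h3 := h2.differentiableWithinAt (by simp)
  simp only [mfld_simps, Function.comp_def, differentiableWithinAt_univ] at h3
  exact h3

lemma eventually_baseSet (x : M) :
    ∀ᶠ y in 𝓝 x, y ∈ (trivializationAt F V x).baseSet :=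
  (trivializationAt F V x).open_baseSet.mem_nhds (mem_baseSet_trivializationAt F V x)

lemma eventually_chart_symm {p : M → Prop} {x : M} (h : ∀ᶠ y in 𝓝 x, p y) :
    ∀ᶠ z in 𝓝 (chartAt ℂ x x), p ((chartAt ℂ x).symm z) := by
  have h1 := (chartAt ℂ x).continuousAt_symm (mem_chart_target ℂ x)
  rw [ContinuousAt, (chartAt ℂ x).left_inv (mem_chart_source ℂ x)] at h1
  exact h1.eventually h

lemma triv_zero [VectorBundle ℂ F V] {x y : M} (hy : y ∈ (trivializationAt F V x).baseSet) :
    (trivializationAt F V x ⟨y, 0⟩).2 = 0 :=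
  ((trivializationAt F V x).linear ℂ hy).map_zero

lemma triv_add [VectorBundle ℂ F V] {x y : M} (hy : y ∈ (trivializationAt F V x).baseSet)
    (a b : V y) : (trivializationAt F V x ⟨y, a + b⟩).2 =
      (trivializationAt F V x ⟨y, a⟩).2 + (trivializationAt F V x ⟨y, b⟩).2 :=
  ((trivializationAt F V x).linear ℂ hy).map_add a b

lemma triv_smul [VectorBundle ℂ F V] {x y : M} (hy : y ∈ (trivializationAt F V x).baseSet)
    (c : ℂ) (a : V y) : (trivializationAt F V x ⟨y, c • a⟩).2 =
      c • (trivializationAt F V x ⟨y, a⟩).2 :=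
  ((trivializationAt F V x).linear ℂ hy).map_smul c a

lemma SmoothSectionAt.zero [VectorBundle ℂ F V] (x : M) :
    SmoothSectionAt F (0 : ∀ x, V x) x := by
  rw [smoothSectionAt_iff]
  refine (contMDiffAt_const (c := (0 : F))).congr_of_eventuallyEq ?_
  filter_upwards [eventually_baseSet (F := F) (V := V) x] with y hy using triv_zero hy

lemma SmoothSectionAt.add [VectorBundle ℂ F V] {s t : ∀ x, V x} {x : M}
    (hs : SmoothSectionAt F s x) (ht : SmoothSectionAt F t x) :
    SmoothSectionAt F (s + t) x := by
  rw [smoothSectionAt_iff] at *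
  refine (hs.add ht).congr_of_eventuallyEq ?_
  filter_upwards [eventually_baseSet (F := F) (V := V) x] with y hy using triv_add hy _ _

lemma SmoothSectionAt.smul [VectorBundle ℂ F V] {s : ∀ x, V x} {x : M} (c : ℂ)
    (hs : SmoothSectionAt F s x) : SmoothSectionAt F (c • s) x := by
  rw [smoothSectionAt_iff] at *
  have h : ContMDiffAt 𝓘(ℝ, ℂ) 𝓘(ℝ, F) ∞
      (fun y => c • (trivializationAt F V x ⟨y, s y⟩).2) x :=
    (contDiff_const_smul c).contMDiff.contMDiffAt.comp x hs
  refine h.congr_of_eventuallyEq ?_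
  filter_upwards [eventually_baseSet (F := F) (V := V) x] with y hy using triv_smul hy _ _

variable (F) (V) in
/-- The complex vector space `Ω⁰(V)` of smooth sections of `V`. -/
def SmoothSections [VectorBundle ℂ F V] : Submodule ℂ (∀ x, V x) where
  carrier := {s | ∀ x, SmoothSectionAt F s x}
  zero_mem' := SmoothSectionAt.zero
  add_mem' hs ht x := (hs x).add (ht x)
  smul_mem' c _ hs x := (hs x).smul c

variable [VectorBundle ℂ F V]

variable (F) in
/-- The coefficient `∂s/∂z̄ = (∂s/∂x + i ∂s/∂y) / 2` at `x` of the section `s`, for the coordinate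
`z` and the holomorphic trivialization of `V` chosen at `x`, as an element of the fibre. -/
def dbarCoeff (s : ∀ x, V x) (x : M) : V x :=
  (trivializationAt F V x).symmL ℂ x ((1 / 2 : ℂ) •
    (fderiv ℝ (localRep F s x) (chartAt ℂ x x) 1
      + Complex.I • fderiv ℝ (localRep F s x) (chartAt ℂ x x) Complex.I))

lemma triv_symm (x : M) (w : F) :
    (trivializationAt F V x ⟨x, (trivializationAt F V x).symmL ℂ x w⟩).2 = w := by
  have hx := mem_baseSet_trivializationAt F V x
  have h := (trivializationAt F V x).continuousLinearMapAt_symmL (R := ℂ) hx w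
  rwa [Trivialization.continuousLinearMapAt_apply,
    (trivializationAt F V x).coe_linearMapAt_of_mem hx] at h

lemma symm_triv {x y : M} (hy : y ∈ (trivializationAt F V x).baseSet) (a : V y) :
    (trivializationAt F V x).symmL ℂ y (trivializationAt F V x ⟨y, a⟩).2 = a := by
  have h := (trivializationAt F V x).symmL_continuousLinearMapAt (R := ℂ) hy a
  rwa [Trivialization.continuousLinearMapAt_apply,
    (trivializationAt F V x).coe_linearMapAt_of_mem hy] at h

lemma triv_injective {x : M} {a b : V x}
    (h : (trivializationAt F V x ⟨x, a⟩).2 = (trivializationAt F V x ⟨x, b⟩).2) : a = b := by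
  have hx := mem_baseSet_trivializationAt F V x
  rw [← symm_triv hx a, h, symm_triv hx b]

variable [∀ x, IsTopologicalAddGroup (V x)] [∀ x, ContinuousSMul ℂ (V x)]

variable (F) in
/-- The operator `D''` of a holomorphic vector bundle `V` on sections: the `(0,1)`-form
`D''s = ∂s/∂z̄ dz̄`, where `(0,1)`-forms at `x` are the conjugate-linear maps `T_x M → V_x`.
(In Mathlib `T_x M` is `ℂ`, by means of the coordinate chosen at `x`.) -/
def dbar (s : ∀ x, V x) (x : M) : TangentSpace 𝓘(ℂ, ℂ) x →SL[starRingEnd ℂ] V x where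
  toFun v := (starRingEnd ℂ) (show ℂ from v) • dbarCoeff F s x
  map_add' v w := by
    rw [← add_smul, ← map_add]; rfl
  map_smul' c v := by
    rw [← mul_smul, ← map_mul]; rfl
  cont := by
    change Continuous fun v : ℂ => (starRingEnd ℂ) v • dbarCoeff F s x
    exact Complex.continuous_conj.smul continuous_const

lemma dbar_apply (s : ∀ x, V x) (x : M) (v : TangentSpace 𝓘(ℂ, ℂ) x) :
    dbar F s x v = (starRingEnd ℂ) (show ℂ from v) • dbarCoeff F s x := rfl

lemma dbarCoeff_add {s t : ∀ x, V x} {x : M} (hs : SmoothSectionAt F s x)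
    (ht : SmoothSectionAt F t x) :
    dbarCoeff F (s + t) x = dbarCoeff F s x + dbarCoeff F t x := by
  have h : localRep F (s + t) x =ᶠ[𝓝 (chartAt ℂ x x)] localRep F s x + localRep F t x := by
    filter_upwards [eventually_chart_symm (eventually_baseSet (F := F) (V := V) x)] with z hz
      using triv_add hz _ _
  rw [dbarCoeff, dbarCoeff, dbarCoeff, ← map_add, h.fderiv_eq,
    fderiv_add hs.differentiableAt_localRep ht.differentiableAt_localRep]
  congr 1
  simp only [add_apply, smul_add]
  abel

lemma dbarCoeff_smul {s : ∀ x, V x} {x : M} (c : ℂ) (hs : SmoothSectionAt F s x) :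
    dbarCoeff F (c • s) x = c • dbarCoeff F s x := by
  have h : localRep F (c • s) x =ᶠ[𝓝 (chartAt ℂ x x)] c • localRep F s x := by
    filter_upwards [eventually_chart_symm (eventually_baseSet (F := F) (V := V) x)] with z hz
      using triv_smul hz _ _
  rw [dbarCoeff, dbarCoeff, ← ((trivializationAt F V x).symmL ℂ x).map_smul, h.fderiv_eq,
    fderiv_const_smul hs.differentiableAt_localRep]
  congr 1
  have h2 (v : ℂ) : (c • fderiv ℝ (localRep F s x) (chartAt ℂ x x)) v
      = c • fderiv ℝ (localRep F s x) (chartAt ℂ x x) v := rfl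
  rw [h2, h2, smul_comm Complex.I c, ← smul_add, smul_comm c]

lemma dbar_add {s t : ∀ x, V x} {x : M} (hs : SmoothSectionAt F s x)
    (ht : SmoothSectionAt F t x) : dbar F (s + t) x = dbar F s x + dbar F t x := by
  ext v
  simp [dbar_apply, dbarCoeff_add hs ht]

lemma dbar_smul {s : ∀ x, V x} {x : M} (c : ℂ) (hs : SmoothSectionAt F s x) :
    dbar F (c • s) x = c • dbar F s x := by
  ext v
  simp [dbar_apply, dbarCoeff_smul c hs, smul_comm c]

lemma SmoothSectionAt.neg {s : ∀ x, V x} {x : M} (hs : SmoothSectionAt F s x) :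
    SmoothSectionAt F (-s) x := by
  have h := hs.smul (-1)
  rwa [neg_one_smul] at h

lemma dbar_neg {s : ∀ x, V x} {x : M} (hs : SmoothSectionAt F s x) :
    dbar F (-s) x = -dbar F s x := by
  have h := dbarCoeff_smul (-1) hs
  rw [neg_one_smul, neg_one_smul] at h
  ext v
  simp [dbar_apply, h]

variable [IsManifold 𝓘(ℂ, ℂ) ω M]

variable (F V) in
/-- The space `Ω^{0,1}(V)` of smooth `V`-valued `(0,1)`-forms. -/
def Form01 : Submodule ℂ (∀ x : M, TangentSpace 𝓘(ℂ, ℂ) x →SL[starRingEnd ℂ] V x) :=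
  SmoothSections (ℂ →SL[starRingEnd ℂ] F)
    (fun x : M => TangentSpace 𝓘(ℂ, ℂ) x →SL[starRingEnd ℂ] V x)

variable (F V) in
/-- The `D''`-exact forms in `Ω^{0,1}(V)`: those of the form `D''ξ` with `ξ ∈ Ω⁰(V)`. -/
def exactForms : Submodule ℂ (Form01 F V) where
  carrier := {η | ∃ ξ ∈ SmoothSections F V, ∀ x, η.1 x = dbar F ξ x}
  zero_mem' := ⟨0, Submodule.zero_mem _, fun x => by
    have h := dbar_smul (F := F) (V := V) (0 : ℂ) (SmoothSectionAt.zero x)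
    rw [zero_smul, zero_smul] at h
    rw [h]; rfl⟩
  add_mem' := by
    rintro η η' ⟨ξ, hξ, h⟩ ⟨ξ', hξ', h'⟩
    refine ⟨ξ + ξ', Submodule.add_mem _ hξ hξ', fun x => ?_⟩
    rw [dbar_add (hξ x) (hξ' x), ← h, ← h']; rfl
  smul_mem' := by
    rintro c η ⟨ξ, hξ, h⟩
    refine ⟨c • ξ, Submodule.smul_mem _ c hξ, fun x => ?_⟩
    rw [dbar_smul c (hξ x), ← h]; rfl

variable (F V) in
/-- The Dolbeault cohomology `H^{0,1}(V) = Ω^{0,1}(V) / D''(Ω⁰(V))`. As `M` has complex dimension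
one, every `(0,1)`-form is `D''`-closed. -/
def H01 : Type _ := Form01 F V ⧸ exactForms F V

instance : AddCommGroup (H01 F V) := inferInstanceAs (AddCommGroup (Form01 F V ⧸ exactForms F V))

instance : Module ℂ (H01 F V) := inferInstanceAs (Module ℂ (Form01 F V ⧸ exactForms F V))

/-- The cohomology class of a form. -/
def H01.mk (η : Form01 F V) : H01 F V := Submodule.Quotient.mk η

lemma H01.mk_surjective : Function.Surjective (H01.mk : Form01 F V → H01 F V) :=
  Submodule.Quotient.mk_surjective _

lemma H01.mk_eq_zero {η : Form01 F V} :
    H01.mk η = 0 ↔ ∃ ξ ∈ SmoothSections F V, ∀ x, η.1 x = dbar F ξ x :=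
  Submodule.Quotient.mk_eq_zero _

/-- A function of forms that does not change when an exact form `D''ξ` is added to its argument,
as a function of cohomology classes. -/
def H01.lift {α : Type*} (f : Form01 F V → α)
    (hf : ∀ η η' : Form01 F V, ∀ ξ : ∀ x, V x, (∀ x, SmoothSectionAt F ξ x) →
      (∀ x, η'.1 x = η.1 x + dbar F ξ x) → f η = f η') (c : H01 F V) : α :=
  Quotient.liftOn' c f fun η' η h => by
    obtain ⟨ξ, hξ, h⟩ := (Submodule.quotientRel_def _).1 h
    refine (hf η η' ξ hξ fun x => ?_).symm
    rw [← h x]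
    exact (add_sub_cancel (η.1 x) (η'.1 x)).symm

lemma H01.lift_mk {α : Type*} (f : Form01 F V → α)
    (hf : ∀ η η' : Form01 F V, ∀ ξ : ∀ x, V x, (∀ x, SmoothSectionAt F ξ x) →
      (∀ x, η'.1 x = η.1 x + dbar F ξ x) → f η = f η') (η : Form01 F V) :
    H01.lift f hf (H01.mk η) = f η := rfl

/-! ### Divisors and degrees -/

/-- `φ` is a meromorphic section, not identically zero, with divisor `D`, of a line bundle with
fibres in `W`, where `Frame ζ x` means that `ζ` is a regular (holomorphic and nowhere vanishing)
section of the line bundle near `x`: around every `x` one has `φ = z ^ D(x) ζ` for a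
holomorphic coordinate `z` vanishing at `x` and a regular section `ζ`.
The value of `φ` at `x` itself is irrelevant. -/
def HasDivisor {W : M → Type*} [∀ x, AddCommGroup (W x)] [∀ x, Module ℂ (W x)]
    (Frame : (∀ x, W x) → M → Prop) (φ : ∀ x, W x) (D : M →₀ ℤ) : Prop :=
  ∀ x, ∃ ζ : ∀ y, W y, Frame ζ x ∧
    ∀ᶠ y in 𝓝[≠] x, φ y = (chartAt ℂ x y - chartAt ℂ x x) ^ D x • ζ y

open Classical in
/-- The degree of a line bundle (given by its regular local sections): the degree of the divisor
of any meromorphic section that is not identically zero. On a closed Riemann surface such a section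
exists, so that the convention `⊥` for the contrary case is immaterial. -/
def degreeOf {W : M → Type*} [∀ x, AddCommGroup (W x)] [∀ x, Module ℂ (W x)]
    (Frame : (∀ x, W x) → M → Prop) : EReal :=
  if h : ∃ D : M →₀ ℤ, ∃ φ, HasDivisor Frame φ D then
    (((h.choose.sum fun _ m => m : ℤ) : ℝ) : EReal)
  else ⊥

lemma degreeOf_congr {W : M → Type*} [∀ x, AddCommGroup (W x)] [∀ x, Module ℂ (W x)]
    {Frame Frame' : (∀ x, W x) → M → Prop}
    (h : (fun D : M →₀ ℤ => ∃ φ, HasDivisor Frame φ D) = fun D => ∃ φ, HasDivisor Frame' φ D) :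
    degreeOf Frame = degreeOf Frame' := by
  classical
  have key : ∀ P Q : (M →₀ ℤ) → Prop, P = Q →
      (if h : ∃ D, P D then (((h.choose.sum fun _ m => m : ℤ) : ℝ) : EReal) else ⊥)
        = if h : ∃ D, Q D then (((h.choose.sum fun _ m => m : ℤ) : ℝ) : EReal) else ⊥ := by
    rintro P _ rfl
    rfl
  convert! key _ _ h

variable (F) in
/-- `s` is a holomorphic section of `V` in a neighbourhood of `x`. -/
def HolSectionNear (s : ∀ x, V x) (x : M) : Prop :=
  ∀ᶠ y in 𝓝 x, SmoothSectionAt F s y ∧ dbar F s y = 0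

/-- `ζ` is a regular section of the holomorphic line bundle `L` near `x`. -/
def IsRegularSection (L : M → Type*) [∀ x, AddCommGroup (L x)] [∀ x, Module ℂ (L x)]
    [∀ x, TopologicalSpace (L x)] [∀ x, IsTopologicalAddGroup (L x)]
    [∀ x, ContinuousSMul ℂ (L x)] [TopologicalSpace (TotalSpace ℂ L)] [FiberBundle ℂ L]
    [VectorBundle ℂ ℂ L] (ζ : ∀ x, L x) (x : M) : Prop :=
  HolSectionNear ℂ ζ x ∧ ∀ᶠ y in 𝓝 x, ζ y ≠ 0

/-- The degree of a holomorphic line bundle `L`. -/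
def deg (L : M → Type*) [∀ x, AddCommGroup (L x)] [∀ x, Module ℂ (L x)]
    [∀ x, TopologicalSpace (L x)] [∀ x, IsTopologicalAddGroup (L x)]
    [∀ x, ContinuousSMul ℂ (L x)] [TopologicalSpace (TotalSpace ℂ L)] [FiberBundle ℂ L]
    [VectorBundle ℂ ℂ L] : EReal :=
  degreeOf (IsRegularSection L)

end Bundles

/-! ### Extensions of line bundles -/

section Extensions

open Bundle

variable {M : Type*} [TopologicalSpace M] [ChartedSpace ℂ M] [IsManifold 𝓘(ℂ, ℂ) ω M]
variable (L₁ : M → Type*) [∀ x, AddCommGroup (L₁ x)] [∀ x, Module ℂ (L₁ x)]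
  [∀ x, TopologicalSpace (L₁ x)] [∀ x, IsTopologicalAddGroup (L₁ x)]
  [∀ x, ContinuousSMul ℂ (L₁ x)] [TopologicalSpace (TotalSpace ℂ L₁)] [FiberBundle ℂ L₁]
  [VectorBundle ℂ ℂ L₁]
variable (L₂ : M → Type*) [∀ x, AddCommGroup (L₂ x)] [∀ x, Module ℂ (L₂ x)]
  [∀ x, TopologicalSpace (L₂ x)] [∀ x, IsTopologicalAddGroup (L₂ x)]
  [∀ x, ContinuousSMul ℂ (L₂ x)] [TopologicalSpace (TotalSpace ℂ L₂)] [FiberBundle ℂ L₂]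
  [VectorBundle ℂ ℂ L₂]

/-- The `(0,1)`-forms with values in the line bundle `Hom(L₂, L₁)`. -/
abbrev ExtForm : Type _ := Form01 (ℂ →L[ℂ] ℂ) (fun x : M => L₂ x →L[ℂ] L₁ x)

/-- The space `H^{0,1}(Hom(L₂, L₁))` of extension classes of `L₂` by `L₁`. -/
abbrev ExtClass : Type _ := H01 (ℂ →L[ℂ] ℂ) (fun x : M => L₂ x →L[ℂ] L₁ x)

variable {L₁ L₂}

/-- The extension `0 → L₁ → E → L₂ → 0` given by `η`: the smooth bundle `E = L₁ ⊕ L₂` with the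
operator `D''(s₁, s₂) = (D''s₁ + η s₂, D''s₂)`. Here `D''σ` is evaluated at a tangent vector `v`. -/
def extDbar (η : ExtForm L₁ L₂) (σ : ∀ x, L₁ x × L₂ x) (x : M) (v : TangentSpace 𝓘(ℂ, ℂ) x) :
    L₁ x × L₂ x :=
  (dbar ℂ (fun y => (σ y).1) x v + η.1 x v (σ x).2, dbar ℂ (fun y => (σ y).2) x v)

/-- `σ` is a holomorphic section, in a neighbourhood of `x`, of the extension `E` given by `η`. -/
def ExtHolSectionNear (η : ExtForm L₁ L₂) (σ : ∀ x, L₁ x × L₂ x) (x : M) : Prop :=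
  ∀ᶠ y in 𝓝 x, SmoothSectionAt ℂ (fun y => (σ y).1) y ∧ SmoothSectionAt ℂ (fun y => (σ y).2) y ∧
    ∀ v, extDbar η σ y v = 0

/-- `σ` is a nowhere vanishing holomorphic section of `E` near `x` which spans the lines `J`. -/
def IsRegularSectionOf (η : ExtForm L₁ L₂) (J : ∀ x : M, Submodule ℂ (L₁ x × L₂ x))
    (σ : ∀ x, L₁ x × L₂ x) (x : M) : Prop :=
  ExtHolSectionNear η σ x ∧ ∀ᶠ y in 𝓝 x, σ y ≠ 0 ∧ J y = Submodule.span ℂ {σ y}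

/-- A holomorphic line subbundle `J` of the extension `E` given by `η`: a family of lines in the
fibres of `E`, locally spanned by a nowhere vanishing holomorphic section of `E`. -/
structure LineSubbundle (η : ExtForm L₁ L₂) where
  /-- The line in the fibre over `x`. -/
  fiber (x : M) : Submodule ℂ (L₁ x × L₂ x)
  exists_regular (x : M) : ∃ σ, IsRegularSectionOf η fiber σ x

/-- The degree of a holomorphic line subbundle. -/
def LineSubbundle.deg {η : ExtForm L₁ L₂} (J : LineSubbundle η) : EReal :=
  degreeOf (IsRegularSectionOf η J.fiber)

/-- `div(E)`, for the extension `E` given by the form `η`: the supremum of the degrees of the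
holomorphic line subbundles of `E`. -/
def divForm (η : ExtForm L₁ L₂) : EReal :=
  ⨆ J : LineSubbundle η, J.deg

/-! `div` depends only on the cohomology class of `η`. -/

lemma triv_hom {x y : M} (h₁ : y ∈ (trivializationAt ℂ L₁ x).baseSet)
    (h₂ : y ∈ (trivializationAt ℂ L₂ x).baseSet) (ξ : L₂ y →L[ℂ] L₁ y) (a : L₂ y) :
    (trivializationAt ℂ L₁ x ⟨y, ξ a⟩).2 =
      (trivializationAt (ℂ →L[ℂ] ℂ) (fun x : M => L₂ x →L[ℂ] L₁ x) x ⟨y, ξ⟩).2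
        (trivializationAt ℂ L₂ x ⟨y, a⟩).2 := by
  rw [hom_trivializationAt_apply]
  simp only [ContinuousLinearMap.inCoordinates, ContinuousLinearMap.comp_apply]
  rw [symm_triv h₂, Trivialization.continuousLinearMapAt_apply,
    (trivializationAt ℂ L₁ x).coe_linearMapAt_of_mem h₁]

lemma smoothSectionAt_apply {ξ : ∀ x : M, L₂ x →L[ℂ] L₁ x} {s : ∀ x, L₂ x} {x : M}
    (hξ : SmoothSectionAt (ℂ →L[ℂ] ℂ) ξ x) (hs : SmoothSectionAt ℂ s x) :
    SmoothSectionAt ℂ (fun y => ξ y (s y)) x := by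
  rw [smoothSectionAt_iff] at *
  have hB : ContDiff ℝ ∞ (fun p : (ℂ →L[ℂ] ℂ) × ℂ => p.1 p.2) :=
    (isBoundedBilinearMap_apply (𝕜 := ℂ) (E := ℂ) (F := ℂ)).contDiff.restrict_scalars ℝ
  have h := hB.contMDiff.contMDiffAt.comp x (hξ.prodMk_space hs)
  refine h.congr_of_eventuallyEq ?_
  filter_upwards [eventually_baseSet (F := ℂ) (V := L₁) x,
    eventually_baseSet (F := ℂ) (V := L₂) x] with y h₁ h₂ using triv_hom h₁ h₂ _ _

lemma dbarCoeff_apply_section {ξ : ∀ x : M, L₂ x →L[ℂ] L₁ x} {s : ∀ x, L₂ x} {x : M}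
    (hξ : SmoothSectionAt (ℂ →L[ℂ] ℂ) ξ x) (hs : SmoothSectionAt ℂ s x) :
    dbarCoeff ℂ (fun y => ξ y (s y)) x
      = dbarCoeff (ℂ →L[ℂ] ℂ) ξ x (s x) + ξ x (dbarCoeff ℂ s x) := by
  have h₁ := mem_baseSet_trivializationAt ℂ L₁ x
  have h₂ := mem_baseSet_trivializationAt ℂ L₂ x
  have heq : localRep ℂ (fun y => ξ y (s y)) x =ᶠ[𝓝 (chartAt ℂ x x)]
      fun z => localRep (ℂ →L[ℂ] ℂ) ξ x z (localRep ℂ s x z) := by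
    filter_upwards [eventually_chart_symm (eventually_baseSet (F := ℂ) (V := L₁) x),
      eventually_chart_symm (eventually_baseSet (F := ℂ) (V := L₂) x)] with z h₁ h₂
      using triv_hom h₁ h₂ _ _
  have hB := ((isBoundedBilinearMap_apply (𝕜 := ℂ) (E := ℂ) (F := ℂ)).hasFDerivAt
    (localRep (ℂ →L[ℂ] ℂ) ξ x (chartAt ℂ x x), localRep ℂ s x (chartAt ℂ x x))).restrictScalars ℝ
  have hD := (hB.comp (chartAt ℂ x x) (hξ.differentiableAt_localRep.hasFDerivAt.prodMk
    hs.differentiableAt_localRep.hasFDerivAt)).fderiv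
  have hD' (v : ℂ) : fderiv ℝ (localRep ℂ (fun y => ξ y (s y)) x) (chartAt ℂ x x) v
      = localRep (ℂ →L[ℂ] ℂ) ξ x (chartAt ℂ x x) (fderiv ℝ (localRep ℂ s x) (chartAt ℂ x x) v)
        + fderiv ℝ (localRep (ℂ →L[ℂ] ℂ) ξ x) (chartAt ℂ x x) v
          (localRep ℂ s x (chartAt ℂ x x)) := by
    rw [heq.fderiv_eq]
    exact DFunLike.congr_fun hD v
  have e₁ : localRep (ℂ →L[ℂ] ℂ) ξ x (chartAt ℂ x x) = (trivializationAt (ℂ →L[ℂ] ℂ)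
      (fun x : M => L₂ x →L[ℂ] L₁ x) x ⟨x, ξ x⟩).2 := by
    rw [localRep, (chartAt ℂ x).left_inv (mem_chart_source ℂ x)]
  have e₂ : localRep ℂ s x (chartAt ℂ x x) = (trivializationAt ℂ L₂ x ⟨x, s x⟩).2 := by
    rw [localRep, (chartAt ℂ x).left_inv (mem_chart_source ℂ x)]
  apply triv_injective (F := ℂ)
  rw [triv_add h₁, triv_hom h₁ h₂, triv_hom h₁ h₂, dbarCoeff, dbarCoeff, dbarCoeff,
    triv_symm, triv_symm, triv_symm, hD', hD', e₁, e₂]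
  generalize (trivializationAt (ℂ →L[ℂ] ℂ) (fun x : M => L₂ x →L[ℂ] L₁ x) x ⟨x, ξ x⟩).2 = g
  rw [g.map_smul, g.map_add, g.map_smul]
  simp only [add_apply, smul_apply, smul_eq_mul]
  ring

lemma dbar_apply_section {ξ : ∀ x : M, L₂ x →L[ℂ] L₁ x} {s : ∀ x, L₂ x} {x : M}
    (hξ : SmoothSectionAt (ℂ →L[ℂ] ℂ) ξ x) (hs : SmoothSectionAt ℂ s x)
    (v : TangentSpace 𝓘(ℂ, ℂ) x) :
    dbar ℂ (fun y => ξ y (s y)) x v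
      = dbar (ℂ →L[ℂ] ℂ) ξ x v (s x) + ξ x (dbar ℂ s x v) := by
  simp only [dbar_apply, dbarCoeff_apply_section hξ hs, smul_add, map_smul]
  rfl

/-- The bundle isomorphism `(s₁, s₂) ↦ (s₁ - ξ s₂, s₂)`. -/
def shear (ξ : ∀ x : M, L₂ x →L[ℂ] L₁ x) (x : M) : (L₁ x × L₂ x) →ₗ[ℂ] (L₁ x × L₂ x) where
  toFun p := (p.1 - ξ x p.2, p.2)
  map_add' p q := by ext <;> simp; abel
  map_smul' c p := by ext <;> simp [smul_sub]

lemma shear_neg_shear (ξ : ∀ x : M, L₂ x →L[ℂ] L₁ x) (x : M) (p : L₁ x × L₂ x) :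
    shear (-ξ) x (shear ξ x p) = p := by
  ext <;> simp [shear]

lemma shear_shear_neg (ξ : ∀ x : M, L₂ x →L[ℂ] L₁ x) (x : M) (p : L₁ x × L₂ x) :
    shear ξ x (shear (-ξ) x p) = p := by
  ext <;> simp [shear]

lemma extHolSectionNear_shear {η η' : ExtForm L₁ L₂} {ξ : ∀ x : M, L₂ x →L[ℂ] L₁ x}
    (hξ : ∀ x, SmoothSectionAt (ℂ →L[ℂ] ℂ) ξ x)
    (h : ∀ x, η'.1 x = η.1 x + dbar (ℂ →L[ℂ] ℂ) ξ x) {σ : ∀ x, L₁ x × L₂ x} {x : M}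
    (hσ : ExtHolSectionNear η σ x) :
    ExtHolSectionNear η' (fun y => shear ξ y (σ y)) x := by
  filter_upwards [hσ] with y ⟨h₁, h₂, h₃⟩
  have hξs := smoothSectionAt_apply (hξ y) h₂
  have hsub : (fun y => (shear ξ y (σ y)).1)
      = (fun y => (σ y).1) + (-1 : ℂ) • (fun y => ξ y (σ y).2) := by
    funext y
    simp [shear, sub_eq_add_neg]
  refine ⟨?_, h₂, fun v => ?_⟩
  · rw [hsub]
    exact h₁.add (hξs.smul _)
  · have h₄ := congrArg Prod.fst (h₃ v)
    have h₅ := congrArg Prod.snd (h₃ v)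
    simp only [extDbar, Prod.fst_zero, Prod.snd_zero] at h₄ h₅
    have h₆ := dbar_apply_section (hξ y) h₂ v
    rw [h₅, map_zero, add_zero] at h₆
    refine Prod.ext ?_ h₅
    simp only [extDbar, Prod.fst_zero]
    rw [hsub, dbar_add h₁ (hξs.smul _), dbar_smul _ hξs, h]
    simp only [add_apply, smul_apply, h₆]
    change _ + _ + (η.1 y v (σ y).2 + dbar (ℂ →L[ℂ] ℂ) ξ y v (σ y).2) = 0
    rw [← h₄]
    simp only [neg_smul, one_smul]
    abel

lemma isRegularSectionOf_shear {η η' : ExtForm L₁ L₂} {ξ : ∀ x : M, L₂ x →L[ℂ] L₁ x}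
    (hξ : ∀ x, SmoothSectionAt (ℂ →L[ℂ] ℂ) ξ x)
    (h : ∀ x, η'.1 x = η.1 x + dbar (ℂ →L[ℂ] ℂ) ξ x)
    {J J' : ∀ x : M, Submodule ℂ (L₁ x × L₂ x)} (hJ : ∀ x, J' x = (J x).map (shear ξ x))
    {σ : ∀ x, L₁ x × L₂ x} {x : M} (hσ : IsRegularSectionOf η J σ x) :
    IsRegularSectionOf η' J' (fun y => shear ξ y (σ y)) x := by
  refine ⟨extHolSectionNear_shear hξ h hσ.1, ?_⟩
  filter_upwards [hσ.2] with y ⟨h₁, h₂⟩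
  refine ⟨fun h₀ => h₁ ?_, ?_⟩
  · rw [← shear_neg_shear ξ y (σ y), h₀, map_zero]
  · rw [hJ, h₂, Submodule.map_span, Set.image_singleton]

lemma hasDivisor_shear {η η' : ExtForm L₁ L₂} {ξ : ∀ x : M, L₂ x →L[ℂ] L₁ x}
    (hξ : ∀ x, SmoothSectionAt (ℂ →L[ℂ] ℂ) ξ x)
    (h : ∀ x, η'.1 x = η.1 x + dbar (ℂ →L[ℂ] ℂ) ξ x)
    {J J' : ∀ x : M, Submodule ℂ (L₁ x × L₂ x)} (hJ : ∀ x, J' x = (J x).map (shear ξ x))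
    {φ : ∀ x, L₁ x × L₂ x} {D : M →₀ ℤ} (hD : HasDivisor (IsRegularSectionOf η J) φ D) :
    HasDivisor (IsRegularSectionOf η' J') (fun y => shear ξ y (φ y)) D := by
  intro x
  obtain ⟨ζ, hζ, hφ⟩ := hD x
  refine ⟨_, isRegularSectionOf_shear hξ h hJ hζ, ?_⟩
  filter_upwards [hφ] with y hy
  rw [hy, map_smul]

/-- The line subbundle corresponding to `J` under the isomorphism `shear ξ` of extensions. -/
def LineSubbundle.map {η η' : ExtForm L₁ L₂} {ξ : ∀ x : M, L₂ x →L[ℂ] L₁ x}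
    (hξ : ∀ x, SmoothSectionAt (ℂ →L[ℂ] ℂ) ξ x)
    (h : ∀ x, η'.1 x = η.1 x + dbar (ℂ →L[ℂ] ℂ) ξ x) (J : LineSubbundle η) :
    LineSubbundle η' where
  fiber x := (J.fiber x).map (shear ξ x)
  exists_regular x :=
    let ⟨_, hσ⟩ := J.exists_regular x
    ⟨_, isRegularSectionOf_shear hξ h (fun _ => rfl) hσ⟩

lemma LineSubbundle.deg_map {η η' : ExtForm L₁ L₂} {ξ : ∀ x : M, L₂ x →L[ℂ] L₁ x}
    (hξ : ∀ x, SmoothSectionAt (ℂ →L[ℂ] ℂ) ξ x)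
    (h : ∀ x, η'.1 x = η.1 x + dbar (ℂ →L[ℂ] ℂ) ξ x) (J : LineSubbundle η) :
    (J.map hξ h).deg = J.deg := by
  have hξ' : ∀ x, SmoothSectionAt (ℂ →L[ℂ] ℂ) (-ξ) x := fun x => (hξ x).neg
  have h' : ∀ x, η.1 x = η'.1 x + dbar (ℂ →L[ℂ] ℂ) (-ξ) x := fun x => by
    rw [dbar_neg (hξ x), h, add_neg_cancel_right]
  have hJ : ∀ x, J.fiber x = ((J.map hξ h).fiber x).map (_root_.shear (-ξ) x) := fun x => by
    ext p
    constructor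
    · exact fun hp => ⟨_, ⟨p, hp, rfl⟩, shear_neg_shear ξ x p⟩
    · rintro ⟨_, ⟨q, hq, rfl⟩, rfl⟩
      rwa [shear_neg_shear]
  have key : (fun D : M →₀ ℤ => ∃ φ, HasDivisor (IsRegularSectionOf η' (J.map hξ h).fiber) φ D)
      = fun D : M →₀ ℤ => ∃ φ, HasDivisor (IsRegularSectionOf η J.fiber) φ D := by
    funext D
    refine propext ⟨?_, ?_⟩
    · rintro ⟨φ, hφ⟩
      exact ⟨_, hasDivisor_shear hξ' h' hJ hφ⟩
    · rintro ⟨φ, hφ⟩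
      exact ⟨_, hasDivisor_shear hξ h (fun _ => rfl) hφ⟩
  exact degreeOf_congr key

lemma divForm_le {η η' : ExtForm L₁ L₂} {ξ : ∀ x : M, L₂ x →L[ℂ] L₁ x}
    (hξ : ∀ x, SmoothSectionAt (ℂ →L[ℂ] ℂ) ξ x)
    (h : ∀ x, η'.1 x = η.1 x + dbar (ℂ →L[ℂ] ℂ) ξ x) : divForm η ≤ divForm η' := by
  refine iSup_le fun J => ?_
  rw [← J.deg_map hξ h]
  exact le_iSup (fun J : LineSubbundle η' => J.deg) (J.map hξ h)

lemma divForm_eq {η η' : ExtForm L₁ L₂} {ξ : ∀ x : M, L₂ x →L[ℂ] L₁ x}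
    (hξ : ∀ x, SmoothSectionAt (ℂ →L[ℂ] ℂ) ξ x)
    (h : ∀ x, η'.1 x = η.1 x + dbar (ℂ →L[ℂ] ℂ) ξ x) : divForm η = divForm η' := by
  refine le_antisymm (divForm_le hξ h) (divForm_le (fun x => (hξ x).neg) fun x => ?_)
  rw [dbar_neg (hξ x), h, add_neg_cancel_right]

/-- `div[η] = div(E)` for an extension class `[η]`, where `E` is the middle term of the extension
given by any representative `η`. -/
def extDiv : ExtClass L₁ L₂ → EReal :=
  H01.lift divForm fun _ _ _ hξ h => divForm_eq hξ h

end Extensions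

end

/-! For a holomorphic line subbundle `J` of `E`, consider the composite `J → E → L₂`. It is
holomorphic, because the second component of `D''_E` is the operator `D''` of `L₂`; hence it
vanishes identically or only at isolated points.

If it vanishes identically, then `J = L₁` and the degrees agree. Otherwise, by compactness, its
zeros form an effective divisor `Z`. A meromorphic section of `J` with divisor `D` projects to one
of `L₂` with divisor `D + Z` (`HasDivisor.snd`), so `deg J = deg L₂ - deg Z ≤ deg L₂`. If equality
holds, then `Z = 0` and `J → L₂` is an isomorphism. Thus `J` is the graph of a smooth `ξ : L₂ → L₁`,
and holomorphy of `J` says `η = -D''ξ`, so the class is zero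
(`LineSubbundle.mk_eq_zero_of_not_isVerticalAt`). `LineSubbundle.deg_cases` collects these
alternatives.

For the equivalence, suppose `deg L₁ < deg L₂`. If the class is nonzero, every `J` has degree less
than `deg L₂`; since degrees are integers (or `⊥`), the supremum is at most `deg L₂ - 1`. If the
class is zero, `L₂` is itself a subbundle of `L₁ ⊕ L₂`.

Two analytic facts carry this. Smooth solutions of `D''s = 0` have analytic coordinate functions
(`HolSectionNear.analyticAt`), so orders of vanishing make sense. A meromorphic function on the
sphere has a divisor of degree zero (`RiemannSphere.sum_order_eq_zero`, from Liouville's theorem),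
so the degree of a line bundle does not depend on the section. -/

noncomputable section

/-! ### Solutions of `D''s = 0` and holomorphic coordinate functions -/

section LocalTheory

open Bundle

variable {M : Type*} [TopologicalSpace M] [ChartedSpace ℂ M]
variable {F : Type*} [NormedAddCommGroup F] [NormedSpace ℂ F]
variable {V : M → Type*} [∀ x, AddCommGroup (V x)] [∀ x, Module ℂ (V x)]
  [∀ x, TopologicalSpace (V x)] [∀ x, IsTopologicalAddGroup (V x)] [∀ x, ContinuousSMul ℂ (V x)]
  [TopologicalSpace (TotalSpace F V)] [FiberBundle F V] [VectorBundle ℂ F V]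

lemma triv_eq_zero_iff {x y : M} (hy : y ∈ (trivializationAt F V x).baseSet) {a : V y} :
    (trivializationAt F V x ⟨y, a⟩).2 = 0 ↔ a = 0 := by
  refine ⟨fun h => ?_, fun h => by rw [h, triv_zero hy]⟩
  rw [← symm_triv hy a, h, map_zero]

lemma triv_symm_of_mem {x y : M} (hy : y ∈ (trivializationAt F V x).baseSet) (w : F) :
    (trivializationAt F V x ⟨y, (trivializationAt F V x).symmL ℂ y w⟩).2 = w := by
  have h := (trivializationAt F V x).continuousLinearMapAt_symmL (R := ℂ) hy w
  rwa [Trivialization.continuousLinearMapAt_apply,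
    (trivializationAt F V x).coe_linearMapAt_of_mem hy] at h

lemma dbar_eq_zero_iff {s : ∀ x, V x} {x : M} : dbar F s x = 0 ↔ dbarCoeff F s x = 0 := by
  constructor
  · intro h
    have h1 := dbar_apply (F := F) s x (1 : ℂ)
    rw [h] at h1
    have h2 : (starRingEnd ℂ) (1 : ℂ) • dbarCoeff F s x = 0 := h1.symm
    rwa [map_one, one_smul] at h2
  · intro h
    ext v
    rw [dbar_apply, h, smul_zero]
    rfl

/-- These are the Cauchy–Riemann equations: `∂s/∂x + i ∂s/∂y = 0` means `∂s/∂y = i ∂s/∂x`, which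
together with real differentiability is complex differentiability. -/
lemma dbarCoeff_eq_zero_iff {s : ∀ x, V x} {x : M} (hs : SmoothSectionAt F s x) :
    dbarCoeff F s x = 0 ↔ DifferentiableAt ℂ (localRep F s x) (chartAt ℂ x x) := by
  rw [differentiableAt_complex_iff_differentiableAt_real,
    and_iff_right hs.differentiableAt_localRep, dbarCoeff]
  have hinj (w : F) : (trivializationAt F V x).symmL ℂ x w = 0 ↔ w = 0 := by
    refine ⟨fun h => ?_, fun h => by rw [h, map_zero]⟩
    rw [← triv_symm (V := V) x w, h, triv_zero (mem_baseSet_trivializationAt F V x)]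
  rw [hinj, smul_eq_zero_iff_right (by norm_num)]
  constructor <;> intro h
  · rw [eq_neg_of_add_eq_zero_left h, smul_neg, smul_smul]
    simp
  · rw [h, smul_smul]
    simp

lemma dbarCoeff_congr {s t : ∀ x, V x} {x : M} (h : ∀ᶠ y in 𝓝 x, s y = t y) :
    dbarCoeff F s x = dbarCoeff F t x := by
  have h' : localRep F s x =ᶠ[𝓝 (chartAt ℂ x x)] localRep F t x := by
    filter_upwards [eventually_chart_symm h] with z hz
    rw [localRep, hz, localRep]
  rw [dbarCoeff, dbarCoeff, h'.fderiv_eq]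

lemma dbar_congr {s t : ∀ x, V x} {x : M} (h : ∀ᶠ y in 𝓝 x, s y = t y) :
    dbar F s x = dbar F t x := by
  ext v
  rw [dbar_apply, dbar_apply, dbarCoeff_congr h]

lemma dbar_zero (x : M) : dbar F (0 : ∀ x, V x) x = 0 := by
  have h := dbar_smul (F := F) (V := V) (0 : ℂ) (SmoothSectionAt.zero x)
  rwa [zero_smul, zero_smul] at h

lemma SmoothSectionAt.congr {s t : ∀ x, V x} {x : M} (hs : SmoothSectionAt F s x)
    (h : ∀ᶠ y in 𝓝 x, s y = t y) : SmoothSectionAt F t x := by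
  refine ContMDiffAt.congr_of_eventuallyEq hs ?_
  filter_upwards [h] with y hy
  rw [hy]

/-- A complex differentiable local representation, as differentiability on the manifold. -/
lemma mdifferentiableAt_triv_iff {s : ∀ x, V x} {x : M} (hs : SmoothSectionAt F s x) :
    MDifferentiableAt 𝓘(ℂ, ℂ) 𝓘(ℂ, F) (fun y => (trivializationAt F V x ⟨y, s y⟩).2) x ↔
      DifferentiableAt ℂ (localRep F s x) (chartAt ℂ x x) := by
  rw [mdifferentiableAt_iff, and_iff_right (smoothSectionAt_iff.1 hs).continuousAt]
  simp only [mfld_simps, Function.comp_def, differentiableWithinAt_univ]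
  rfl

lemma ContMDiffAt.restrict_scalars_real {f : M → F} {x : M}
    (h : ContMDiffAt 𝓘(ℂ, ℂ) 𝓘(ℂ, F) ω f x) : ContMDiffAt 𝓘(ℝ, ℂ) 𝓘(ℝ, F) ∞ f x := by
  rw [contMDiffAt_iff] at *
  refine ⟨h.1, ?_⟩
  have h2 := h.2
  simp only [mfld_simps, Function.comp_def, contDiffWithinAt_univ] at h2 ⊢
  exact (h2.restrict_scalars ℝ).of_le le_top

variable [IsManifold 𝓘(ℂ, ℂ) ω M] [ContMDiffVectorBundle ω F V 𝓘(ℂ, ℂ)]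

/-- The equation `D''s = 0` at `y` is expressed in the chart and trivialization chosen at `y`, not
those at `x`. As the transition maps are holomorphic, the representation at `x` is complex
differentiable on a whole neighbourhood, hence analytic. -/
lemma HolSectionNear.analyticAt [CompleteSpace F] {s : ∀ x, V x} {x : M}
    (hs : HolSectionNear F s x) : AnalyticAt ℂ (localRep F s x) (chartAt ℂ x x) := by
  rw [Complex.analyticAt_iff_eventually_differentiableAt]
  have : IsManifold 𝓘(ℂ, ℂ) 1 M := IsManifold.of_le (n := ω) le_top
  have : ContMDiffVectorBundle 1 F V 𝓘(ℂ, ℂ) := ContMDiffVectorBundle.of_le (n := ω) le_top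
  filter_upwards [eventually_chart_symm hs, eventually_chart_symm (eventually_baseSet (F := F)
    (V := V) x), (chartAt ℂ x).open_target.mem_nhds (mem_chart_target ℂ x)] with z h hb ht
  have h1 := (mdifferentiableAt_triv_iff h.1).2
    ((dbarCoeff_eq_zero_iff h.1).1 (dbar_eq_zero_iff.1 h.2))
  -- Passage from the trivialization and chart at the nearby point to those at `x`.
  rw [← mdifferentiableAt_section 𝓘(ℂ, ℂ),
    (trivializationAt F V x).mdifferentiableAt_section_iff _ _ hb,
    mdifferentiableAt_iff_of_mem_source (x := x) (y := 0) ((chartAt ℂ x).map_target ht)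
      (Set.mem_univ _)] at h1
  have h2 := h1.2
  simp only [mfld_simps, Function.comp_def, differentiableWithinAt_univ,
    (chartAt ℂ x).right_inv ht] at h2
  exact h2

lemma holSectionNear_of_contMDiffAt {s : ∀ x, V x} {x : M}
    (hs : ∀ᶠ y in 𝓝 x, ContMDiffAt 𝓘(ℂ, ℂ) 𝓘(ℂ, F) ω
      (fun y' => (trivializationAt F V y ⟨y', s y'⟩).2) y) : HolSectionNear F s x := by
  filter_upwards [hs] with y h
  have h1 : SmoothSectionAt F s y := smoothSectionAt_iff.2 h.restrict_scalars_real
  exact ⟨h1, dbar_eq_zero_iff.2 ((dbarCoeff_eq_zero_iff h1).2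
    ((mdifferentiableAt_triv_iff h1).1 (h.mdifferentiableAt (by simp))))⟩

/-- The section with the given holomorphic coordinate function. -/
lemma holSectionNear_symmL [CompleteSpace F] {h : ℂ → F} {x : M}
    (hh : AnalyticAt ℂ h (chartAt ℂ x x)) :
    HolSectionNear F (fun y => (trivializationAt F V x).symmL ℂ y (h (chartAt ℂ x y))) x := by
  apply holSectionNear_of_contMDiffAt
  have hc := (chartAt ℂ x).continuousAt (mem_chart_source ℂ x)
  filter_upwards [(eventually_baseSet (F := F) (V := V) x).eventually_nhds,
    (chartAt ℂ x).open_source.mem_nhds (mem_chart_source ℂ x),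
    hc.eventually hh.eventually_analyticAt] with y hb hy ha
  rw [← contMDiffAt_section, (trivializationAt F V x).contMDiffAt_section_iff hb.self_of_nhds]
  have h1 : ContMDiffAt 𝓘(ℂ, ℂ) 𝓘(ℂ, F) ω (fun y => h (chartAt ℂ x y)) y :=
    ha.contDiffAt.contMDiffAt.comp y (contMDiffAt_of_mem_maximalAtlas
      (IsManifold.chart_mem_maximalAtlas x) hy)
  refine h1.congr_of_eventuallyEq ?_
  filter_upwards [hb] with y' hb' using triv_symm_of_mem hb' _

end LocalTheory

/-! ### Entire functions without zeros -/

section Entire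

open Filter

/-- A function which extends holomorphically across every point extends to an entire function. -/
lemma exists_entire_extension {h : ℂ → ℂ}
    (hh : ∀ a, ∃ v : ℂ → ℂ, AnalyticAt ℂ v a ∧ v a ≠ 0 ∧ ∀ᶠ z in 𝓝[≠] a, h z = v z) :
    ∃ H : ℂ → ℂ, Differentiable ℂ H ∧ (∀ a, H a ≠ 0) ∧ ∀ a, ∀ᶠ z in 𝓝[≠] a, h z = H z := by
  choose v hv hv0 hhv using hh
  -- Near `z` both `v a` and `v z` agree with `h` off `z`, so by continuity they agree at `z`. Hence
  -- the diagonal `z ↦ v z z` coincides with `v a` near `a`.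
  have key (a : ℂ) : ∀ᶠ z in 𝓝 a, v a z = v z z := by
    have h1 := eventually_nhdsNE_eventually_nhds_iff.2 (hhv a)
    rw [eventually_nhdsWithin_iff] at h1
    filter_upwards [h1, (hv a).eventually_analyticAt] with z hz haz
    rcases eq_or_ne z a with rfl | hza
    · rfl
    refine tendsto_nhds_unique_of_eventuallyEq
      (haz.continuousAt.tendsto.mono_left nhdsWithin_le_nhds)
      ((hv z).continuousAt.tendsto.mono_left nhdsWithin_le_nhds) (f := v a) (g := v z)
      (l := 𝓝[≠] z) ?_
    filter_upwards [hhv z, (hz hza).filter_mono nhdsWithin_le_nhds] with y h2 h3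
    rw [← h2, h3]
  refine ⟨fun z => v z z, fun a => ?_, fun a => hv0 a, fun a => ?_⟩
  · exact (hv a).differentiableAt.congr_of_eventuallyEq ((key a).mono fun z hz => hz.symm)
  · filter_upwards [hhv a, (key a).filter_mono nhdsWithin_le_nhds] with z h1 h2
    rw [h1, h2]

/-- An entire function without zeros which behaves like `z ^ n` at infinity is constant. -/
lemma eq_zero_of_tendsto_zpow_mul {H : ℂ → ℂ} (hH : Differentiable ℂ H) (h0 : ∀ a, H a ≠ 0)
    {n : ℤ} {c : ℂ} (hc : c ≠ 0)
    (ht : Tendsto (fun z => z ^ n * H z) (cocompact ℂ) (𝓝 c)) : n = 0 := by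
  -- For a positive exponent `G` tends to `0` at infinity, so it vanishes by Liouville's theorem,
  -- contrary to `hG0`. A negative exponent is reduced to this case by passing to `1 / H`.
  have main : ∀ (G : ℂ → ℂ) (m : ℤ) (d : ℂ), Differentiable ℂ G → (∀ a, G a ≠ 0) →
      Tendsto (fun z => z ^ m * G z) (cocompact ℂ) (𝓝 d) → ¬ 0 < m := by
    intro G m d hG hG0 htG hm
    lift m to ℕ using hm.le
    have hm' : m ≠ 0 := by rintro rfl; simp at hm
    have hz : Tendsto (fun z : ℂ => (z ^ m)⁻¹) (cocompact ℂ) (𝓝 0) := by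
      have h1 : Tendsto (fun z : ℂ => z⁻¹ ^ m) (cocompact ℂ) (𝓝 (0 ^ m)) :=
        (tendsto_inv₀_cobounded.mono_left Metric.cobounded_eq_cocompact.ge).pow m
      simpa [hm'] using h1
    have h2 := hz.mul htG
    rw [zero_mul] at h2
    have h3 : Tendsto G (cocompact ℂ) (𝓝 0) := by
      refine h2.congr' ?_
      have h4 : ∀ᶠ z : ℂ in cocompact ℂ, z ≠ 0 := by
        rw [← Metric.cobounded_eq_cocompact]
        exact Bornology.isBounded_def.1 (Bornology.isBounded_singleton (x := (0 : ℂ)))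
      filter_upwards [h4] with z hz
      rw [zpow_natCast]
      field_simp
    exact hG0 0 (hG.apply_eq_of_tendsto_cocompact 0 h3)
  rcases lt_trichotomy n 0 with h | h | h
  · refine absurd (neg_pos.2 h) (main (fun z => (H z)⁻¹) (-n) c⁻¹ (hH.inv h0)
      (fun a => inv_ne_zero (h0 a)) ?_)
    refine (ht.inv₀ hc).congr fun z => ?_
    rw [mul_inv, zpow_neg]
  · exact h
  · exact absurd h (main H n c hH h0 ht)

end Entire

/-! ### Degree of the divisor of a meromorphic function on the sphere -/

namespace RiemannSphere

open Filter

/-- A meromorphic function on the sphere has as many zeros as poles. -/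
theorem sum_order_eq_zero {f : OnePoint ℂ → ℂ} {D : OnePoint ℂ →₀ ℤ}
    (hf : ∀ x, ∃ u : ℂ → ℂ, AnalyticAt ℂ u (chartAt ℂ x x) ∧ u (chartAt ℂ x x) ≠ 0 ∧
      ∀ᶠ y in 𝓝[≠] x, f y = (chartAt ℂ x y - chartAt ℂ x x) ^ D x * u (chartAt ℂ x y)) :
    (D.sum fun _ m => m) = 0 := by
  classical
  -- the finite part of the divisor
  set S : Finset ℂ := D.support.preimage ((↑) : ℂ → OnePoint ℂ)
    (OnePoint.coe_injective.injOn) with hS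
  have hsum : (D.sum fun _ m => m) = D OnePoint.infty + ∑ a ∈ S, D (a : OnePoint ℂ) := by
    have h1 : (∑ a ∈ S, D (a : OnePoint ℂ)) =
        ∑ x ∈ D.support.filter (fun x => x ∈ Set.range ((↑) : ℂ → OnePoint ℂ)), D x :=
      Finset.sum_preimage' _ _ _ _
    have h2 : (∑ x ∈ D.support.filter (fun x => ¬ x ∈ Set.range ((↑) : ℂ → OnePoint ℂ)), D x)
        = D OnePoint.infty := by
      have h3 : D.support.filter (fun x => ¬ x ∈ Set.range ((↑) : ℂ → OnePoint ℂ))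
          = D.support.filter (fun x => x = OnePoint.infty) := by
        refine Finset.filter_congr fun x _ => ?_
        induction x using OnePoint.rec <;> simp
      rw [h3, Finset.sum_filter]
      simp +contextual
    rw [h1, ← h2, add_comm, Finset.sum_filter_add_sum_filter_not]
    rfl
  -- `P` cancels the finite zeros and poles, so that `f * P` extends to an entire function `H`
  -- without zeros.
  set P : ℂ → ℂ := fun z => ∏ a ∈ S, (z - a) ^ (-D (a : OnePoint ℂ)) with hP
  obtain ⟨H, hHd, hH0, hH⟩ := exists_entire_extension (h := fun z => f z * P z) fun a => by
    obtain ⟨u, hu, hu0, hfu⟩ := hf (a : OnePoint ℂ)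
    have hch : chartAt ℂ (a : OnePoint ℂ) = zChart := rfl
    simp only [hch, zChart_coe] at hu hu0 hfu
    have hfu' : ∀ᶠ z : ℂ in 𝓝[≠] a, f z = (z - a) ^ D (a : OnePoint ℂ) * u z := by
      have ht : Tendsto ((↑) : ℂ → OnePoint ℂ) (𝓝[≠] a) (𝓝[≠] (a : OnePoint ℂ)) :=
        tendsto_nhdsWithin_of_tendsto_nhds_of_eventually_within _
          (OnePoint.continuous_coe.continuousAt.tendsto.mono_left nhdsWithin_le_nhds)
          (by filter_upwards [self_mem_nhdsWithin] with z hz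
              simpa using hz)
      filter_upwards [ht.eventually hfu] with z hz
      rwa [zChart_coe] at hz
    -- The factor of `P` at `a` cancels `(z - a) ^ D a`; the remaining factors are analytic and
    -- nonzero at `a`.
    refine ⟨fun z => u z * ∏ b ∈ S.erase a, (z - b) ^ (-D (b : OnePoint ℂ)), ?_, ?_, ?_⟩
    · refine hu.mul ?_
      refine Finset.analyticAt_fun_prod _ fun b hb => ?_
      refine (analyticAt_id.sub analyticAt_const).zpow ?_
      exact sub_ne_zero.2 (Finset.ne_of_mem_erase hb).symm
    · refine mul_ne_zero hu0 (Finset.prod_ne_zero_iff.2 fun b hb => zpow_ne_zero _ ?_)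
      exact sub_ne_zero.2 (Finset.ne_of_mem_erase hb).symm
    · filter_upwards [hfu', self_mem_nhdsWithin] with z hz hza
      have hza' : z - a ≠ 0 := sub_ne_zero.2 hza
      have hPz : P z = (z - a) ^ (-D (a : OnePoint ℂ))
          * ∏ b ∈ S.erase a, (z - b) ^ (-D (b : OnePoint ℂ)) := by
        by_cases haS : a ∈ S
        · exact (Finset.mul_prod_erase S _ haS).symm
        · have : D (a : OnePoint ℂ) = 0 := by simpa [hS] using haS
          rw [this, Finset.erase_eq_of_notMem haS]
          simp [hP]
      rw [hz, hPz, zpow_neg]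
      field_simp
  obtain ⟨u, hu, hu0, hfu⟩ := hf OnePoint.infty
  have hch : chartAt ℂ (OnePoint.infty : OnePoint ℂ) = wChart := rfl
  have hw0 : wChart (OnePoint.infty : OnePoint ℂ) = 0 := by
    rw [wChart_apply, inv_infty, zChart_coe]
  simp only [hch, hw0] at hu hu0 hfu
  have hne : ∀ᶠ z : ℂ in cocompact ℂ, z ≠ 0 := by
    rw [← Metric.cobounded_eq_cocompact]
    exact Bornology.isBounded_def.1 (Bornology.isBounded_singleton (x := (0 : ℂ)))
  have hinv : Tendsto (fun z : ℂ => z⁻¹) (cocompact ℂ) (𝓝 0) :=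
    tendsto_inv₀_cobounded.mono_left Metric.cobounded_eq_cocompact.ge
  -- `H` agrees with `f * P` only off isolated points. Equality at every `z` near infinity follows
  -- by continuity of both sides, for which `z ∉ S` is needed.
  have hHinf : ∀ᶠ z : ℂ in cocompact ℂ, H z = (z⁻¹) ^ D OnePoint.infty * u z⁻¹ * P z := by
    have ht : Tendsto ((↑) : ℂ → OnePoint ℂ) (cocompact ℂ) (𝓝[≠] OnePoint.infty) := by
      rw [← coclosedCompact_eq_cocompact]
      refine tendsto_nhdsWithin_of_tendsto_nhds_of_eventually_within _
        OnePoint.tendsto_coe_infty (Eventually.of_forall fun z => by simp)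
    have hS' : ∀ᶠ z : ℂ in cocompact ℂ, z ∉ S := S.finite_toSet.isCompact.compl_mem_cocompact
    filter_upwards [ht.eventually (eventually_nhdsNE_eventually_nhds_iff.2 hfu), hne, hS',
      hinv.eventually hu.eventually_analyticAt] with z hz hz0 hzS hzu
    have hc : ContinuousAt (fun z => (z⁻¹) ^ D OnePoint.infty * u z⁻¹ * P z) z := by
      have hi : ContinuousAt (fun z : ℂ => z⁻¹) z := continuousAt_inv₀ hz0
      refine ((hi.zpow₀ _ (Or.inl (inv_ne_zero hz0))).mul
        (hzu.continuousAt.comp (f := fun z : ℂ => z⁻¹) hi)).mul ?_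
      refine tendsto_finsetProd _ fun a ha => ?_
      refine ContinuousAt.zpow₀ (by fun_prop) _ (Or.inl (sub_ne_zero.2 ?_))
      rintro rfl
      exact hzS ha
    refine tendsto_nhds_unique_of_eventuallyEq (l := 𝓝[≠] z)
      ((hHd z).continuousAt.tendsto.mono_left nhdsWithin_le_nhds)
      (hc.tendsto.mono_left nhdsWithin_le_nhds) ?_
    filter_upwards [hH z, (OnePoint.continuous_coe.continuousAt.eventually hz).filter_mono
      nhdsWithin_le_nhds, (eventually_ne_nhds hz0).filter_mono nhdsWithin_le_nhds] with y h1 h2 h3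
    rw [wChart_apply, inv_coe h3, zChart_coe, sub_zero] at h2
    rw [← h1, h2]
  rw [hsum]
  -- Near infinity `H` is `z ^ (-D ∞) * u (1 / z) * P z`, and `P` behaves like `z` to the power
  -- minus the finite degree. Multiplication by `z` to the power of the total degree therefore
  -- leaves the limit `u 0 ≠ 0`.
  refine eq_zero_of_tendsto_zpow_mul hHd hH0 hu0 ?_
  have hu' : Tendsto (fun z : ℂ => u z⁻¹ * ∏ a ∈ S, (1 - a * z⁻¹) ^ (-D (a : OnePoint ℂ)))
      (cocompact ℂ) (𝓝 (u 0 * ∏ a ∈ S, (1 - a * 0) ^ (-D (a : OnePoint ℂ)))) := by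
    refine (hu.continuousAt.tendsto.comp hinv).mul (tendsto_finsetProd _ fun a _ => ?_)
    exact (tendsto_const_nhds.sub (hinv.const_mul a)).zpow₀ _ (by simp)
  simp only [mul_zero, sub_zero, one_zpow, Finset.prod_const_one, mul_one] at hu'
  refine hu'.congr' ?_
  filter_upwards [hHinf, hne] with z h1 h0
  rw [h1, zpow_add₀ h0, inv_zpow]
  have h3 : ∏ a ∈ S, (1 - a * z⁻¹) ^ (-D (a : OnePoint ℂ))
      = z ^ (∑ a ∈ S, D (a : OnePoint ℂ)) * P z := by
    have hsumpow : z ^ (∑ a ∈ S, D (a : OnePoint ℂ)) = ∏ a ∈ S, z ^ D (a : OnePoint ℂ) := by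
      refine Finset.induction_on S (by simp) fun a s ha ih => ?_
      rw [Finset.sum_insert ha, Finset.prod_insert ha, zpow_add₀ h0, ih]
    rw [hP, hsumpow, ← Finset.prod_mul_distrib]
    refine Finset.prod_congr rfl fun a _ => ?_
    have : 1 - a * z⁻¹ = z⁻¹ * (z - a) := by field_simp
    rw [this, mul_zpow, inv_zpow, zpow_neg, _root_.inv_inv]
  rw [h3]
  have := zpow_ne_zero (D OnePoint.infty) h0
  field_simp

end RiemannSphere

/-! ### Orders of vanishing and quotients of sections of a line bundle -/

section Divisors

open Bundle Filter

variable {M : Type*} [TopologicalSpace M] [ChartedSpace ℂ M] [IsManifold 𝓘(ℂ, ℂ) ω M]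
variable {L : M → Type*} [∀ x, AddCommGroup (L x)] [∀ x, Module ℂ (L x)]
  [∀ x, TopologicalSpace (L x)] [∀ x, IsTopologicalAddGroup (L x)]
  [∀ x, ContinuousSMul ℂ (L x)] [TopologicalSpace (TotalSpace ℂ L)] [FiberBundle ℂ L]
  [VectorBundle ℂ ℂ L]

lemma localRep_chart {F : Type*} [NormedAddCommGroup F] [NormedSpace ℂ F] {V : M → Type*}
    [∀ x, AddCommGroup (V x)] [∀ x, Module ℂ (V x)] [∀ x, TopologicalSpace (V x)]
    [TopologicalSpace (TotalSpace F V)] [FiberBundle F V] (s : ∀ x, V x) {x y : M}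
    (hy : y ∈ (chartAt ℂ x).source) :
    localRep F s x (chartAt ℂ x y) = (trivializationAt F V x ⟨y, s y⟩).2 := by
  rw [localRep, (chartAt ℂ x).left_inv hy]

lemma eventually_chart_source (x : M) : ∀ᶠ y in 𝓝 x, y ∈ (chartAt ℂ x).source :=
  (chartAt ℂ x).open_source.mem_nhds (mem_chart_source ℂ x)

lemma tendsto_chart (x : M) : Tendsto (chartAt ℂ x) (𝓝 x) (𝓝 (chartAt ℂ x x)) :=
  (chartAt ℂ x).continuousAt (mem_chart_source ℂ x)

lemma eventually_chart_sub_ne_zero (x : M) :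
    ∀ᶠ y in 𝓝[≠] x, chartAt ℂ x y - chartAt ℂ x x ≠ 0 := by
  filter_upwards [(eventually_chart_source x).filter_mono nhdsWithin_le_nhds,
    self_mem_nhdsWithin] with y hy hne
  exact sub_ne_zero.2 fun h => hne ((chartAt ℂ x).injOn hy (mem_chart_source ℂ x) h)

/-- Charts take values in `ℂ`, which has no isolated points. This gives content to conditions on
punctured neighbourhoods. -/
lemma neBot_nhdsNE_of_chartedSpace (x : M) : (𝓝[≠] x).NeBot := by
  refine ⟨fun h => ?_⟩
  have h1 : ∀ᶠ y in 𝓝 x, y = x := by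
    have h2 : ∀ᶠ y in 𝓝[≠] x, False := by rw [h]; exact eventually_bot
    filter_upwards [eventually_nhdsWithin_iff.1 h2] with y hy
    by_contra hne
    exact hy hne
  have h3 : ∀ᶠ z in 𝓝[≠] (chartAt ℂ x x), False := by
    rw [eventually_nhdsWithin_iff]
    filter_upwards [eventually_chart_symm h1,
      (chartAt ℂ x).open_target.mem_nhds (mem_chart_target ℂ x)] with z hz ht hne
    exact hne (by rw [← (chartAt ℂ x).right_inv ht, hz]; rfl)
  exact h3.exists.choose_spec

lemma eq_smul_of_triv {x y : M} (hy : y ∈ (trivializationAt ℂ L x).baseSet) {a b : L y}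
    (hb : b ≠ 0) : a = ((trivializationAt ℂ L x ⟨y, a⟩).2 / (trivializationAt ℂ L x ⟨y, b⟩).2) • b
    := by
  have h0 := mt (triv_eq_zero_iff hy).1 hb
  nth_rw 1 [← symm_triv hy a]
  rw [← symm_triv hy (_ • b), triv_smul hy, smul_eq_mul, div_mul_cancel₀ _ h0]

/-- The quotient of two vectors in a fibre of a line bundle. -/
def fiberRatio {x : M} (a b : L x) : ℂ :=
  (trivializationAt ℂ L x ⟨x, a⟩).2 / (trivializationAt ℂ L x ⟨x, b⟩).2

lemma fiberRatio_smul {x : M} (c : ℂ) {b : L x} (hb : b ≠ 0) : fiberRatio (c • b) b = c := by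
  have hx := mem_baseSet_trivializationAt ℂ L x
  have h0 := mt (triv_eq_zero_iff hx).1 hb
  rw [fiberRatio, triv_smul hx, smul_eq_mul, mul_div_cancel_right₀ _ h0]

variable [ContMDiffVectorBundle ω ℂ L 𝓘(ℂ, ℂ)]

lemma IsRegularSection.localRep_ne_zero {ζ : ∀ x, L x} {x : M} (h : IsRegularSection L ζ x) :
    localRep ℂ ζ x (chartAt ℂ x x) ≠ 0 := by
  rw [localRep_chart _ (mem_chart_source ℂ x), Ne,
    triv_eq_zero_iff (mem_baseSet_trivializationAt ℂ L x)]
  exact h.2.self_of_nhds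

/-- The quotient of two meromorphic sections is a meromorphic function. -/
lemma HasDivisor.fiberRatio {φ ψ : ∀ x, L x} {D D' : M →₀ ℤ}
    (hφ : HasDivisor (IsRegularSection L) φ D) (hψ : HasDivisor (IsRegularSection L) ψ D') (x : M) :
    ∃ u : ℂ → ℂ, AnalyticAt ℂ u (chartAt ℂ x x) ∧ u (chartAt ℂ x x) ≠ 0 ∧
      ∀ᶠ y in 𝓝[≠] x, fiberRatio (φ y) (ψ y) =
        (chartAt ℂ x y - chartAt ℂ x x) ^ (D - D') x * u (chartAt ℂ x y) := by
  obtain ⟨ζ, hζ, h1⟩ := hφ x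
  obtain ⟨ζ', hζ', h2⟩ := hψ x
  refine ⟨fun z => localRep ℂ ζ x z / localRep ℂ ζ' x z,
    hζ.1.analyticAt.div hζ'.1.analyticAt hζ'.localRep_ne_zero,
    div_ne_zero hζ.localRep_ne_zero hζ'.localRep_ne_zero, ?_⟩
  filter_upwards [h1, h2, eventually_chart_sub_ne_zero x,
    (eventually_baseSet (F := ℂ) (V := L) x).filter_mono nhdsWithin_le_nhds,
    (eventually_chart_source x).filter_mono nhdsWithin_le_nhds,
    hζ'.2.filter_mono nhdsWithin_le_nhds] with y e1 e2 hne hb hs h0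
  have hD' := zpow_ne_zero (D' x) hne
  have h3 : φ y = ((chartAt ℂ x y - chartAt ℂ x x) ^ (D - D') x *
      (localRep ℂ ζ x (chartAt ℂ x y) / localRep ℂ ζ' x (chartAt ℂ x y))) • ψ y := by
    rw [e1, e2, localRep_chart _ hs, localRep_chart _ hs]
    nth_rw 1 [eq_smul_of_triv hb h0 (a := ζ y)]
    rw [smul_smul, smul_smul, Finsupp.sub_apply, zpow_sub₀ hne]
    congr 1
    field_simp
  rw [h3, fiberRatio_smul]
  rw [e2]
  exact smul_ne_zero hD' h0

lemma isRegularSection_symmL {g : ℂ → ℂ} {x : M} (hg : AnalyticAt ℂ g (chartAt ℂ x x))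
    (hg0 : g (chartAt ℂ x x) ≠ 0) :
    IsRegularSection L (fun y => (trivializationAt ℂ L x).symmL ℂ y (g (chartAt ℂ x y))) x := by
  refine ⟨holSectionNear_symmL hg, ?_⟩
  filter_upwards [eventually_baseSet (F := ℂ) (V := L) x,
    (tendsto_chart x).eventually (hg.continuousAt.eventually_ne hg0)] with y h1 h2 h3
  have h4 := triv_symm_of_mem h1 (g (chartAt ℂ x y))
  rw [h3, triv_zero h1] at h4
  exact h2 h4.symm

/-- A holomorphic section of a line bundle vanishes identically near `x`, or to a finite order. -/
lemma HolSectionNear.eventually_zero_or_eq_pow_smul {s : ∀ x, L x} {x : M}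
    (hs : HolSectionNear ℂ s x) : (∀ᶠ y in 𝓝 x, s y = 0) ∨ ∃ (k : ℕ) (ζ : ∀ x, L x),
      IsRegularSection L ζ x ∧
        ∀ᶠ y in 𝓝 x, s y = (chartAt ℂ x y - chartAt ℂ x x) ^ k • ζ y := by
  have hb := eventually_baseSet (F := ℂ) (V := L) x
  by_cases h : ∀ᶠ z in 𝓝 (chartAt ℂ x x), localRep ℂ s x z = 0
  · left
    filter_upwards [(tendsto_chart x).eventually h, hb, eventually_chart_source x] with y h1 h2 h3
    rwa [localRep_chart _ h3, triv_eq_zero_iff h2] at h1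
  · right
    obtain ⟨k, g, hg, hg0, hsg⟩ := hs.analyticAt.exists_eventuallyEq_pow_smul_nonzero_iff.2 h
    refine ⟨k, fun y => (trivializationAt ℂ L x).symmL ℂ y (g (chartAt ℂ x y)),
      isRegularSection_symmL hg hg0, ?_⟩
    filter_upwards [(tendsto_chart x).eventually hsg, hb, eventually_chart_source x]
      with y h1 h2 h3
    rw [← map_smul, ← h1, localRep_chart _ h3, symm_triv h2]

end Divisors

/-! ### Independence of the degree from the meromorphic section -/

section SphereDegree

open Bundle

variable {L : OnePoint ℂ → Type*} [∀ x, AddCommGroup (L x)] [∀ x, Module ℂ (L x)]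
  [∀ x, TopologicalSpace (L x)] [∀ x, IsTopologicalAddGroup (L x)]
  [∀ x, ContinuousSMul ℂ (L x)] [TopologicalSpace (TotalSpace ℂ L)] [FiberBundle ℂ L]
  [VectorBundle ℂ ℂ L] [ContMDiffVectorBundle ω ℂ L 𝓘(ℂ, ℂ)]

/-- The quotient `φ / ψ` is a meromorphic function with divisor `D - D'`, which has degree zero. -/
lemma HasDivisor.sum_eq {φ ψ : ∀ x, L x} {D D' : OnePoint ℂ →₀ ℤ}
    (hφ : HasDivisor (IsRegularSection L) φ D) (hψ : HasDivisor (IsRegularSection L) ψ D') :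
    (D.sum fun _ m => m) = D'.sum fun _ m => m := by
  have h := RiemannSphere.sum_order_eq_zero (hφ.fiberRatio hψ)
  rwa [Finsupp.sum_sub_index (fun _ _ _ => rfl), sub_eq_zero] at h

/-- The degree of a line bundle on the sphere is that of any of its meromorphic sections. -/
lemma HasDivisor.deg_eq {φ : ∀ x, L x} {D : OnePoint ℂ →₀ ℤ}
    (hφ : HasDivisor (IsRegularSection L) φ D) :
    deg L = (((D.sum fun _ m => m : ℤ) : ℝ) : EReal) := by
  have h : ∃ D : OnePoint ℂ →₀ ℤ, ∃ φ, HasDivisor (IsRegularSection L) φ D := ⟨D, φ, hφ⟩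
  obtain ⟨ψ, hψ⟩ := h.choose_spec
  rw [deg, degreeOf, dif_pos h, hψ.sum_eq hφ]

end SphereDegree

/-! ### The projection of a line subbundle to `L₂` -/

section Subbundles

open Bundle Filter

variable {M : Type*} [TopologicalSpace M] [ChartedSpace ℂ M] [IsManifold 𝓘(ℂ, ℂ) ω M]

lemma degreeOf_eq_bot_or_exists {W : M → Type*} [∀ x, AddCommGroup (W x)] [∀ x, Module ℂ (W x)]
    (Frame : (∀ x, W x) → M → Prop) : degreeOf Frame = ⊥ ∨ ∃ D φ, HasDivisor Frame φ D ∧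
      degreeOf Frame = (((D.sum fun _ m => m : ℤ) : ℝ) : EReal) := by
  by_cases h : ∃ D : M →₀ ℤ, ∃ φ, HasDivisor Frame φ D
  · obtain ⟨ψ, hψ⟩ := h.choose_spec
    exact Or.inr ⟨h.choose, ψ, hψ, dif_pos h⟩
  · exact Or.inl (dif_neg h)

variable {L₁ : M → Type*} [∀ x, AddCommGroup (L₁ x)] [∀ x, Module ℂ (L₁ x)]
  [∀ x, TopologicalSpace (L₁ x)] [∀ x, IsTopologicalAddGroup (L₁ x)]
  [∀ x, ContinuousSMul ℂ (L₁ x)] [TopologicalSpace (TotalSpace ℂ L₁)] [FiberBundle ℂ L₁]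
  [VectorBundle ℂ ℂ L₁]
variable {L₂ : M → Type*} [∀ x, AddCommGroup (L₂ x)] [∀ x, Module ℂ (L₂ x)]
  [∀ x, TopologicalSpace (L₂ x)] [∀ x, IsTopologicalAddGroup (L₂ x)]
  [∀ x, ContinuousSMul ℂ (L₂ x)] [TopologicalSpace (TotalSpace ℂ L₂)] [FiberBundle ℂ L₂]
  [VectorBundle ℂ ℂ L₂]
variable {η : ExtForm L₁ L₂}

lemma ExtHolSectionNear.snd {σ : ∀ x, L₁ x × L₂ x} {x : M} (h : ExtHolSectionNear η σ x) :
    HolSectionNear ℂ (fun y => (σ y).2) x := by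
  filter_upwards [h] with y hy
  refine ⟨hy.2.1, ?_⟩
  ext v
  exact congrArg Prod.snd (hy.2.2 v)

/-- Where the second component vanishes, the term `η s₂` drops out of `D''_E`. -/
lemma ExtHolSectionNear.fst {σ : ∀ x, L₁ x × L₂ x} {x : M} (h : ExtHolSectionNear η σ x)
    (h0 : ∀ᶠ y in 𝓝 x, (σ y).2 = 0) : HolSectionNear ℂ (fun y => (σ y).1) x := by
  filter_upwards [h, h0] with y hy hy0
  refine ⟨hy.1, ?_⟩
  ext v
  have h1 := congrArg Prod.fst (hy.2.2 v)
  simp only [extDbar, hy0, map_zero, add_zero] at h1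
  exact h1

/-- The fibre of `J` at `x` is contained in `L₁`. -/
def LineSubbundle.IsVerticalAt (J : LineSubbundle η) (x : M) : Prop := ∀ p ∈ J.fiber x, p.2 = 0

lemma LineSubbundle.isVerticalAt_iff {J : LineSubbundle η} {x : M} {p : L₁ x × L₂ x}
    (hp : J.fiber x = Submodule.span ℂ {p}) : J.IsVerticalAt x ↔ p.2 = 0 := by
  rw [LineSubbundle.IsVerticalAt, hp]
  refine ⟨fun h => h p (Submodule.mem_span_singleton_self p), fun h q hq => ?_⟩
  obtain ⟨c, rfl⟩ := Submodule.mem_span_singleton.1 hq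
  rw [Prod.smul_snd, h, smul_zero]

/-- A section of a line subbundle contained in `L₁` is a section of `L₁`. -/
lemma HasDivisor.fst_of_isVerticalAt {J : LineSubbundle η} (hJ : ∀ x, J.IsVerticalAt x)
    {φ : ∀ x, L₁ x × L₂ x} {D : M →₀ ℤ} (hφ : HasDivisor (IsRegularSectionOf η J.fiber) φ D) :
    HasDivisor (IsRegularSection L₁) (fun x => (φ x).1) D := by
  intro x
  obtain ⟨σ, hσ, h⟩ := hφ x
  have h0 : ∀ᶠ y in 𝓝 x, (σ y).2 = 0 :=
    hσ.2.mono fun y hy => (LineSubbundle.isVerticalAt_iff hy.2).1 (hJ y)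
  refine ⟨fun y => (σ y).1, ⟨hσ.1.fst h0, ?_⟩, ?_⟩
  · filter_upwards [hσ.2, h0] with y h1 h2 h3
    exact h1.1 (Prod.ext h3 h2)
  · filter_upwards [h] with y hy
    rw [hy, Prod.smul_fst]

section

variable [ContMDiffVectorBundle ω ℂ L₂ 𝓘(ℂ, ℂ)]

/-- The vertical points near `x` are the zeros of the `L₂`-component of a local holomorphic section
spanning `J`, so the dichotomy for zeros of holomorphic sections applies. -/
lemma LineSubbundle.eventually_isVerticalAt_or (J : LineSubbundle η) (x : M) :
    (∀ᶠ y in 𝓝 x, J.IsVerticalAt y) ∨ ∀ᶠ y in 𝓝[≠] x, ¬ J.IsVerticalAt y := by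
  obtain ⟨σ, hσ⟩ := J.exists_regular x
  refine hσ.1.snd.eventually_zero_or_eq_pow_smul.imp (fun h => ?_) ?_
  · filter_upwards [h, hσ.2] with y h1 h2 using (isVerticalAt_iff h2.2).2 h1
  · rintro ⟨k, ζ, hζ, h⟩
    filter_upwards [h.filter_mono nhdsWithin_le_nhds, hσ.2.filter_mono nhdsWithin_le_nhds,
      hζ.2.filter_mono nhdsWithin_le_nhds, eventually_chart_sub_ne_zero x] with y h1 h2 h3 h4
    rw [isVerticalAt_iff h2.2, h1]
    exact smul_ne_zero (pow_ne_zero _ h4) h3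

/-- A line subbundle is contained in `L₁`, or it is so at isolated points only. -/
lemma LineSubbundle.isVerticalAt_or_eventually_not [PreconnectedSpace M] (J : LineSubbundle η) :
    (∀ x, J.IsVerticalAt x) ∨ ∀ x, ∀ᶠ y in 𝓝[≠] x, ¬ J.IsVerticalAt y := by
  -- Closedness: a point outside the set has a punctured neighbourhood free of vertical points,
  -- which therefore does not meet the set.
  have hclopen : IsClopen {x | ∀ᶠ y in 𝓝 x, J.IsVerticalAt y} := by
    refine ⟨⟨isOpen_iff_mem_nhds.2 fun x hx => ?_⟩, isOpen_setOfPred_eventually_nhds⟩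
    have h := (J.eventually_isVerticalAt_or x).resolve_left hx
    rw [eventually_nhdsWithin_iff] at h
    filter_upwards [h] with y hy hy'
    rcases eq_or_ne y x with rfl | hne
    · exact hx hy'
    · exact hy hne hy'.self_of_nhds
  rcases isClopen_iff.1 hclopen with h | h
  · refine Or.inr fun x => (J.eventually_isVerticalAt_or x).resolve_left fun hx => ?_
    have : x ∈ (∅ : Set M) := h ▸ hx
    exact this
  · refine Or.inl fun x => ?_
    have : x ∈ {x | ∀ᶠ y in 𝓝 x, J.IsVerticalAt y} := h ▸ Set.mem_univ x
    exact this.self_of_nhds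

/-- Each point has a neighbourhood in which it alone can satisfy `p`, and finitely many of these
cover. -/
lemma finite_setOf_of_eventually_not [CompactSpace M] {p : M → Prop}
    (h : ∀ x, ∀ᶠ y in 𝓝[≠] x, ¬ p y) : {x | p x}.Finite := by
  have h' : ∀ x, {y | y ≠ x → ¬ p y} ∈ 𝓝 x := fun x => eventually_nhdsWithin_iff.1 (h x)
  obtain ⟨t, -, ht⟩ := isCompact_univ.elim_nhds_subcover _ fun x _ => h' x
  refine t.finite_toSet.subset fun y hy => ?_
  obtain ⟨x, hx, hyx⟩ := Set.mem_iUnion₂.1 (ht (Set.mem_univ y))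
  by_contra hne
  exact hyx (by rintro rfl; exact hne hx) hy

/-- The projection to `L₂` of a meromorphic section of a line subbundle not contained in `L₁`. -/
lemma HasDivisor.snd [CompactSpace M] {J : LineSubbundle η}
    (hJ : ∀ x, ∀ᶠ y in 𝓝[≠] x, ¬ J.IsVerticalAt y)
    {φ : ∀ x, L₁ x × L₂ x} {D : M →₀ ℤ} (hφ : HasDivisor (IsRegularSectionOf η J.fiber) φ D) :
    ∃ Z : M →₀ ℤ, (∀ x, 0 ≤ Z x) ∧ (∀ x, Z x = 0 ↔ ¬ J.IsVerticalAt x) ∧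
      HasDivisor (IsRegularSection L₂) (fun x => (φ x).2) (D + Z) := by
  -- If `φ = z ^ D(x) σ` and the `L₂`-component of the regular section `σ` vanishes to order `k` at
  -- `x`, the projection of `φ` has order `D x + k`. These `k` are the values of `Z`.
  have key : ∀ x, ∃ (k : ℕ) (ζ : ∀ y, L₂ y), IsRegularSection L₂ ζ x ∧
      (k = 0 ↔ ¬ J.IsVerticalAt x) ∧
      ∀ᶠ y in 𝓝[≠] x, (φ y).2 = (chartAt ℂ x y - chartAt ℂ x x) ^ (D x + k) • ζ y := by
    intro x
    obtain ⟨σ, hσ, h⟩ := hφ x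
    have hvert := hσ.2.mono fun y hy => LineSubbundle.isVerticalAt_iff (J := J) hy.2
    rcases hσ.1.snd.eventually_zero_or_eq_pow_smul with h0 | ⟨k, ζ, hζ, hk⟩
    -- Identical vanishing near `x` would make all nearby points vertical, against `hJ`.
    · have := neBot_nhdsNE_of_chartedSpace x
      obtain ⟨y, h1, h2, h3⟩ := ((h0.filter_mono nhdsWithin_le_nhds).and
        ((hvert.filter_mono nhdsWithin_le_nhds).and (hJ x))).exists
      exact absurd (h2.2 h1) h3
    · refine ⟨k, ζ, hζ, ?_, ?_⟩
      · rw [hvert.self_of_nhds, hk.self_of_nhds, sub_self, smul_eq_zero, not_or,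
          and_iff_left hζ.2.self_of_nhds]
        simp
      · filter_upwards [h, hk.filter_mono nhdsWithin_le_nhds, eventually_chart_sub_ne_zero x]
          with y h1 h2 h3
        rw [h1, Prod.smul_snd, h2, smul_smul, zpow_add₀ h3, zpow_natCast]
  choose k ζ hζ hk h using key
  have hfin : {x | J.IsVerticalAt x}.Finite := finite_setOf_of_eventually_not hJ
  refine ⟨Finsupp.onFinset hfin.toFinset (fun x => (k x : ℤ)) fun x hx => ?_, fun x => ?_,
    fun x => ?_, fun x => ⟨ζ x, hζ x, ?_⟩⟩
  · rw [Set.Finite.mem_toFinset, Set.mem_ofPred_eq]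
    by_contra hv
    exact hx (by rw [(hk x).2 hv]; rfl)
  · simp
  · simpa using hk x
  · simpa using h x

end

/-- The subbundle `J` splits the extension if it is nowhere tangent to `L₁`. -/
lemma LineSubbundle.mk_eq_zero_of_not_isVerticalAt {J : LineSubbundle η}
    (hJ : ∀ x, ¬ J.IsVerticalAt x) : H01.mk η = 0 := by
  have hspan : ∀ x, ∃ p : L₁ x × L₂ x, J.fiber x = Submodule.span ℂ {p} ∧ p.2 ≠ 0 := fun x => by
    obtain ⟨σ, hσ⟩ := J.exists_regular x
    have h := hσ.2.self_of_nhds.2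
    exact ⟨σ x, h, mt (isVerticalAt_iff h).2 (hJ x)⟩
  choose p hp hp0 using hspan
  -- `ξ` is the fibrewise linear map whose graph is `J`: it sends `(p x).2` to `(p x).1`.
  obtain ⟨ξ, hξ⟩ : ∃ ξ : ∀ x : M, L₂ x →L[ℂ] L₁ x, ∀ x, ∀ q ∈ J.fiber x, ξ x q.2 = q.1 := by
    refine ⟨fun x => ((trivializationAt ℂ L₂ x).continuousLinearMapAt ℂ x).smulRight
      ((trivializationAt ℂ L₂ x ⟨x, (p x).2⟩).2⁻¹ • (p x).1), fun x q hq => ?_⟩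
    have hx := mem_baseSet_trivializationAt ℂ L₂ x
    rw [hp] at hq
    obtain ⟨c, rfl⟩ := Submodule.mem_span_singleton.1 hq
    rw [ContinuousLinearMap.smulRight_apply, Trivialization.continuousLinearMapAt_apply,
      (trivializationAt ℂ L₂ x).coe_linearMapAt_of_mem hx, Prod.smul_snd, Prod.smul_fst,
      ← mul_inv_cancel_right₀ (mt (triv_eq_zero_iff hx).1 (hp0 x)) c]
    beta_reduce
    rw [triv_smul hx, smul_smul, smul_eq_mul, mul_inv_cancel_right₀
      (mt (triv_eq_zero_iff hx).1 (hp0 x))]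
  have hfr (x : M) : ∃ σ : ∀ y, L₁ y × L₂ y, ExtHolSectionNear η σ x ∧
      (∀ᶠ y in 𝓝 x, ξ y (σ y).2 = (σ y).1) ∧ ∀ᶠ y in 𝓝 x, (σ y).2 ≠ 0 := by
    obtain ⟨σ, hσ⟩ := J.exists_regular x
    refine ⟨σ, hσ.1, ?_, ?_⟩
    · filter_upwards [hσ.2] with y hy
      exact hξ y _ (by rw [hy.2]; exact Submodule.mem_span_singleton_self _)
    · filter_upwards [hσ.2] with y hy
      exact mt (isVerticalAt_iff hy.2).2 (hJ y)
  -- In trivializations `ξ` is multiplication by the quotient `σ₁ / σ₂` of the components of a local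
  -- section spanning `J`, and `σ₂` has no zeros.
  have hsm (x : M) : SmoothSectionAt (ℂ →L[ℂ] ℂ) ξ x := by
    obtain ⟨σ, hσ, h1, h2⟩ := hfr x
    have hs := hσ.self_of_nhds
    have s1 := smoothSectionAt_iff.1 hs.1
    have s2 := smoothSectionAt_iff.1 hs.2.1
    rw [smoothSectionAt_iff]
    have hdiv : ContDiffAt ℝ ∞ (fun q : ℂ × ℂ => (q.1 / q.2) • ContinuousLinearMap.id ℂ ℂ)
        ((trivializationAt ℂ L₁ x ⟨x, (σ x).1⟩).2, (trivializationAt ℂ L₂ x ⟨x, (σ x).2⟩).2) := by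
      have h3 : ContDiffAt ℂ ∞ (fun q : ℂ × ℂ => q.1 / q.2)
          ((trivializationAt ℂ L₁ x ⟨x, (σ x).1⟩).2, (trivializationAt ℂ L₂ x ⟨x, (σ x).2⟩).2) :=
        contDiffAt_fst.div contDiffAt_snd ?_
      · exact (h3.smul contDiffAt_const).restrict_scalars ℝ
      exact mt (triv_eq_zero_iff (mem_baseSet_trivializationAt ℂ L₂ x)).1 h2.self_of_nhds
    refine (hdiv.contMDiffAt.comp x (s1.prodMk_space s2)).congr_of_eventuallyEq ?_
    filter_upwards [h1, h2, eventually_baseSet (F := ℂ) (V := L₁) x,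
      eventually_baseSet (F := ℂ) (V := L₂) x] with y e1 e2 b1 b2
    have h0 := mt (triv_eq_zero_iff b2).1 e2
    have h3 := triv_hom b1 b2 (ξ y) (σ y).2
    rw [e1] at h3
    generalize (trivializationAt (ℂ →L[ℂ] ℂ) (fun x : M => L₂ x →L[ℂ] L₁ x) x ⟨y, ξ y⟩).2 = g
      at h3 ⊢
    ext
    have h4 : g (trivializationAt ℂ L₂ x ⟨y, (σ y).2⟩).2
        = (trivializationAt ℂ L₂ x ⟨y, (σ y).2⟩).2 * g 1 := by
      rw [← smul_eq_mul, ← map_smul, smul_eq_mul, mul_one]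
    rw [h4] at h3
    simp only [Function.comp_apply, smul_apply, ContinuousLinearMap.id_apply, smul_eq_mul, mul_one]
    rw [h3, mul_div_cancel_left₀ _ h0]
  -- As `σ₁ = ξ σ₂` and `D''σ₂ = 0`, the Leibniz rule gives `D''σ₁ = (D''ξ) σ₂`. The first component
  -- of `D''_E σ = 0` then reads `(D''ξ + η) σ₂ = 0`, and `σ₂` spans the fibre.
  refine H01.mk_eq_zero.2 ⟨-ξ, fun x => (hsm x).neg, fun x => ?_⟩
  obtain ⟨σ, hσ, h1, h2⟩ := hfr x
  obtain ⟨t1, t2, t3⟩ := hσ.self_of_nhds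
  rw [dbar_neg (hsm x)]
  ext v a
  have h3 := dbar_apply_section (hsm x) t2 v
  have h4 : dbar ℂ (fun y => (σ y).2) x v = 0 := congrArg Prod.snd (t3 v)
  have h5 : dbar ℂ (fun y => (σ y).1) x v + η.1 x v (σ x).2 = 0 := congrArg Prod.fst (t3 v)
  rw [h4, map_zero, add_zero, dbar_congr h1] at h3
  rw [h3] at h5
  have h6 := eq_smul_of_triv (mem_baseSet_trivializationAt ℂ L₂ x) h2.self_of_nhds (a := a)
  rw [h6, map_smul, map_smul]
  congr 1
  exact eq_neg_of_add_eq_zero_right h5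

lemma IsRegularSection.inr {ζ : ∀ x, L₂ x} {x : M} (h : IsRegularSection L₂ ζ x) :
    IsRegularSectionOf (0 : ExtForm L₁ L₂) (fun _ => Submodule.prod ⊥ ⊤)
      (fun y => (0, ζ y)) x := by
  constructor
  · filter_upwards [h.1] with y hy
    refine ⟨SmoothSectionAt.zero y, hy.1, fun v => ?_⟩
    refine Prod.ext ?_ (DFunLike.congr_fun hy.2 v)
    have h0 : dbar ℂ (fun y => (0 : L₁ y)) y v = 0 := DFunLike.congr_fun (dbar_zero y) v
    exact (congrArg₂ (· + ·) h0 rfl).trans (add_zero _)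
  · filter_upwards [h.2] with y hy
    refine ⟨fun h0 => hy (congrArg Prod.snd h0), ?_⟩
    ext ⟨a, b⟩
    rw [Submodule.mem_prod, Submodule.mem_span_singleton]
    constructor
    · rintro ⟨ha, -⟩
      refine ⟨_, Prod.ext ?_ (eq_smul_of_triv (mem_baseSet_trivializationAt ℂ L₂ y) hy).symm⟩
      rw [Prod.smul_fst, smul_zero]
      exact ((Submodule.mem_bot ℂ).1 ha).symm
    · rintro ⟨c, hc⟩
      refine ⟨(Submodule.mem_bot ℂ).2 ?_, Submodule.mem_top⟩
      rw [← congrArg Prod.fst hc, Prod.smul_fst, smul_zero]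

lemma HasDivisor.inr {φ : ∀ x, L₂ x} {D : M →₀ ℤ} (hφ : HasDivisor (IsRegularSection L₂) φ D) :
    HasDivisor (IsRegularSectionOf (0 : ExtForm L₁ L₂) (fun _ => Submodule.prod ⊥ ⊤))
      (fun y => (0, φ y)) D := by
  intro x
  obtain ⟨ζ, hζ, h⟩ := hφ x
  refine ⟨_, hζ.inr, ?_⟩
  filter_upwards [h] with y hy
  rw [hy, Prod.smul_mk, smul_zero]

/-- The line subbundle `L₂` of the trivial extension. -/
def LineSubbundle.inr [ContMDiffVectorBundle ω ℂ L₂ 𝓘(ℂ, ℂ)] :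
    LineSubbundle (0 : ExtForm L₁ L₂) where
  fiber _ := Submodule.prod ⊥ ⊤
  exists_regular _ :=
    ⟨_, (isRegularSection_symmL (g := fun _ => 1) analyticAt_const one_ne_zero).inr⟩

end Subbundles

/-! ### Degrees of line subbundles on the sphere and their supremum -/

section SphereExtensions

open Bundle Filter

variable {L₁ : OnePoint ℂ → Type*} [∀ x, AddCommGroup (L₁ x)] [∀ x, Module ℂ (L₁ x)]
  [∀ x, TopologicalSpace (L₁ x)] [∀ x, IsTopologicalAddGroup (L₁ x)]
  [∀ x, ContinuousSMul ℂ (L₁ x)] [TopologicalSpace (TotalSpace ℂ L₁)] [FiberBundle ℂ L₁]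
  [VectorBundle ℂ ℂ L₁] [ContMDiffVectorBundle ω ℂ L₁ 𝓘(ℂ, ℂ)]
variable {L₂ : OnePoint ℂ → Type*} [∀ x, AddCommGroup (L₂ x)] [∀ x, Module ℂ (L₂ x)]
  [∀ x, TopologicalSpace (L₂ x)] [∀ x, IsTopologicalAddGroup (L₂ x)]
  [∀ x, ContinuousSMul ℂ (L₂ x)] [TopologicalSpace (TotalSpace ℂ L₂)] [FiberBundle ℂ L₂]
  [VectorBundle ℂ ℂ L₂] [ContMDiffVectorBundle ω ℂ L₂ 𝓘(ℂ, ℂ)]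
variable {η : ExtForm L₁ L₂}

/-- A line subbundle with a meromorphic section either has the degree of `L₁`, or its degree is at
most that of `L₂`, with equality only for split extensions. -/
lemma LineSubbundle.deg_cases (J : LineSubbundle η) :
    J.deg = ⊥ ∨ J.deg = _root_.deg L₁ ∨ (J.deg ≤ _root_.deg L₂ ∧ (J.deg = _root_.deg L₂ → H01.mk η = 0)) := by
  refine (degreeOf_eq_bot_or_exists (IsRegularSectionOf η J.fiber)).imp_right ?_
  -- `D` is the very divisor that defines `J.deg`, so independence of the section is needed only for
  -- `L₁` and `L₂`.
  rintro ⟨D, φ, hφ, hdeg⟩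
  change J.deg = _ at hdeg
  rcases J.isVerticalAt_or_eventually_not with hJ | hJ
  · left
    rw [hdeg, (hφ.fst_of_isVerticalAt hJ).deg_eq]
  · right
    obtain ⟨Z, hZ, hZ', h⟩ := hφ.snd hJ
    have hsum0 : 0 ≤ Z.sum fun _ m => m := Finset.sum_nonneg fun x _ => hZ x
    rw [hdeg, h.deg_eq, Finsupp.sum_add_index' (fun _ => rfl) (fun _ _ _ => rfl)]
    refine ⟨by exact_mod_cast le_add_of_nonneg_right hsum0, fun heq => ?_⟩
    have hsum : (Z.sum fun _ m => m) = 0 := by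
      have : (D.sum fun _ m => m) = (D.sum fun _ m => m) + Z.sum fun _ m => m := by
        exact_mod_cast heq
      linarith
    refine mk_eq_zero_of_not_isVerticalAt (J := J) fun x => (hZ' x).1 ?_
    by_cases hx : x ∈ Z.support
    · exact (Finset.sum_eq_zero_iff_of_nonneg fun x _ => hZ x).1 hsum x hx
    · exact Finsupp.notMem_support_iff.1 hx

/-- A meromorphic section of `L₂` shows that the subbundle has one too. The divisor selected in its
degree may be a different one, but it is also a divisor of a section of `L₂`, because the projection
has no zeros. -/
lemma LineSubbundle.deg_inr (h : _root_.deg L₂ ≠ ⊥) :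
    (LineSubbundle.inr : LineSubbundle (0 : ExtForm L₁ L₂)).deg = _root_.deg L₂ := by
  obtain ⟨D, φ, hφ, -⟩ := (degreeOf_eq_bot_or_exists (IsRegularSection L₂)).resolve_left h
  have hJ : ∀ x, ¬ (LineSubbundle.inr : LineSubbundle (0 : ExtForm L₁ L₂)).IsVerticalAt x := by
    intro x hx
    exact (isRegularSection_symmL (L := L₂) (x := x) (g := fun _ => 1) analyticAt_const
      one_ne_zero).2.self_of_nhds (hx (0, _) ⟨(Submodule.mem_bot ℂ).2 rfl, Submodule.mem_top⟩)
  have hex : ∃ D φ, HasDivisor (IsRegularSectionOf (0 : ExtForm L₁ L₂)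
    (LineSubbundle.inr : LineSubbundle (0 : ExtForm L₁ L₂)).fiber) φ D := ⟨D, _, hφ.inr⟩
  obtain ⟨ψ, hψ⟩ := hex.choose_spec
  obtain ⟨Z, -, hZ, h'⟩ := hψ.snd fun x => Filter.Eventually.of_forall hJ
  have hZ0 : Z = 0 := Finsupp.ext fun x => (hZ x).2 (hJ x)
  rw [hZ0, add_zero] at h'
  rw [h'.deg_eq]
  exact dif_pos hex

lemma degreeOf_eq_bot_or_eq_intCast {M : Type*} [TopologicalSpace M] [ChartedSpace ℂ M]
    [IsManifold 𝓘(ℂ, ℂ) ω M] {W : M → Type*} [∀ x, AddCommGroup (W x)] [∀ x, Module ℂ (W x)]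
    (Frame : (∀ x, W x) → M → Prop) :
    degreeOf Frame = ⊥ ∨ ∃ n : ℤ, degreeOf Frame = ((n : ℝ) : EReal) :=
  (degreeOf_eq_bot_or_exists Frame).imp_right fun ⟨_, _, _, h⟩ => ⟨_, h⟩

lemma divForm_le_max (η : ExtForm L₁ L₂) : divForm η ≤ max (deg L₁) (deg L₂) := by
  refine iSup_le fun J => ?_
  rcases J.deg_cases with h | h | h
  · rw [h]
    exact bot_le
  · rw [h]
    exact le_max_left _ _
  · exact h.1.trans (le_max_right _ _)

/-- A supremum need not be attained, so strict inequality for each `J` would not suffice.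
Integrality of degrees supplies the uniform bound `deg L₂ - 1`. -/
lemma mk_eq_zero_of_divForm_eq (hlt : deg L₁ < deg L₂) (h : divForm η = deg L₂) :
    H01.mk η = 0 := by
  by_contra hne
  obtain ⟨n, hn⟩ := (degreeOf_eq_bot_or_eq_intCast (IsRegularSection L₂)).resolve_left
    (bot_le.trans_lt hlt).ne'
  change deg L₂ = _ at hn
  have hle : divForm η ≤ (((n - 1 : ℤ) : ℝ) : EReal) := by
    refine iSup_le fun J => ?_
    rcases degreeOf_eq_bot_or_eq_intCast (IsRegularSectionOf η J.fiber) with hJ | ⟨m, hJ⟩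
    · exact hJ.trans_le bot_le
    change J.deg = _ at hJ
    have hJlt : J.deg < deg L₂ := by
      rcases J.deg_cases with h1 | h1 | h1
      · rw [h1]
        exact bot_le.trans_lt hlt
      · rwa [h1]
      · exact lt_of_le_of_ne h1.1 fun h2 => hne (h1.2 h2)
    rw [hJ, hn] at hJlt
    rw [hJ]
    have : m < n := by exact_mod_cast hJlt
    exact_mod_cast Int.le_sub_one_of_lt this
  rw [h, hn] at hle
  have : n ≤ n - 1 := by exact_mod_cast hle
  omega

lemma le_divForm_zero (h : deg L₂ ≠ ⊥) : deg L₂ ≤ divForm (0 : ExtForm L₁ L₂) := by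
  rw [← LineSubbundle.deg_inr (L₁ := L₁) h]
  exact le_iSup (fun J : LineSubbundle (0 : ExtForm L₁ L₂) => J.deg) _

end SphereExtensions

end

theorem mainTheorem12
    (L₁ : OnePoint ℂ → Type*) [∀ x, AddCommGroup (L₁ x)] [∀ x, Module ℂ (L₁ x)]
    [∀ x, TopologicalSpace (L₁ x)] [∀ x, IsTopologicalAddGroup (L₁ x)]
    [∀ x, ContinuousSMul ℂ (L₁ x)] [TopologicalSpace (Bundle.TotalSpace ℂ L₁)]
    [FiberBundle ℂ L₁] [VectorBundle ℂ ℂ L₁] [ContMDiffVectorBundle ω ℂ L₁ 𝓘(ℂ, ℂ)]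
    (L₂ : OnePoint ℂ → Type*) [∀ x, AddCommGroup (L₂ x)] [∀ x, Module ℂ (L₂ x)]
    [∀ x, TopologicalSpace (L₂ x)] [∀ x, IsTopologicalAddGroup (L₂ x)]
    [∀ x, ContinuousSMul ℂ (L₂ x)] [TopologicalSpace (Bundle.TotalSpace ℂ L₂)]
    [FiberBundle ℂ L₂] [VectorBundle ℂ ℂ L₂] [ContMDiffVectorBundle ω ℂ L₂ 𝓘(ℂ, ℂ)]
    (η : ExtClass L₁ L₂) :
    extDiv η ≤ max (deg L₁) (deg L₂) ∧
      (deg L₁ < deg L₂ → (extDiv η = max (deg L₁) (deg L₂) ↔ η = 0)) := by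
  obtain ⟨η, rfl⟩ := H01.mk_surjective η
  refine ⟨divForm_le_max η, fun hlt => ?_⟩
  rw [max_eq_right hlt.le]
  refine ⟨mk_eq_zero_of_divForm_eq hlt, fun h => ?_⟩
  rw [h]
  -- The strict inequality of degrees excludes `deg L₂ = ⊥`, so `L₂` has a meromorphic section.
  refine le_antisymm ?_ (le_divForm_zero (bot_le.trans_lt hlt).ne')
  exact (divForm_le_max 0).trans_eq (max_eq_right hlt.le)
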